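/- Let $m\ge 2$, let $U_{n_i}\in\mathbb C^{n_i\times n_i}$ ($3\le i\le m$), and let $L(\mathcal A)=\mathcal A\times_3U_{n_3}\times\cdots\times_mU_{n_m}$ act on tensors of any size $a\times b\times n_3\times\cdots\times n_m$. Assume that $W=U_{n_m}\otimes\cdots\otimes U_{n_3}$ satisfies $WW^*=W^*W=\rho I$ for some $\rho>0$. Let $\mathcal A*_L\mathcal B$ be the tensor such that each frontal slice of $L(\mathcal A*_L\mathcal B)$ is the product of the corresponding slices of $L(\mathcal A)$ and $L(\mathcal B)$; let $\mathcal A^*$ be the tensor such that the frontal slices of $L(\mathcal A^*)$ are the conjugate transposes of those of $L(\mathcal A)$; and let $\mathcal J$ be the tensor such that all frontal slices of $L(\mathcal J)$ are identity matrices. Assume that $*_L$ is an operation on real tensors: $\mathcal A*_L\mathcal B$ is real whenever $\mathcal A$ and $\mathcal B$ are real. A t-SVD of $\mathcal X\in\mathbb R^{n_1\times n_2\times\cdots\times n_m}$ is a factorization $\mathcal X=\mathcal U*_L\mathcal S*_L\mathcal V^*$ with real tensors $\mathcal U,\mathcal S,\mathcal V$, where $\mathcal U\in\mathbb R^{n_1\times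 n_1\times n_3\times\cdots\times n_m}$ and $\mathcal V\in\mathbb R^{n_2\times n_2\times n_3\times\cdots\times n_m}$ are orthogonal ($\mathcal U^**_L\mathcal U=\mathcal U*_L\mathcal U^*=\mathcal J$, and likewise for $\mathcal V$) and the core $\mathcal S\in\mathbb R^{n_1\times n_2\times\cdots\times n_m}$ is f-diagonal, that is, all its frontal slices are diagonal. Let $\|\cdot\|_1$ be the sum of the absolute values of all entries, let $p\ge1$ be real and $\lambda>0$, and put $$\|\mathcal X\|_{N\ell_1^p}=\inf\{\|\mathcal S\|_1^p:\ \mathcal S\text{ is the core of a t-SVD of }\mathcal X\},\qquad \mathrm{prox}_{\lambda\|\cdot\|_1^p}(\mathcal S)=\operatorname*{argmin}_{\mathcal D\in\mathbb R^{n_1\times\cdots\times n_m}}\ \tfrac12\|\mathcal D-\mathcal S\|_F^2+\lambda\|\mathcal D\|_1^p .$$ **Theorem.** Let $\mathcal Z\in\mathbb R^{n_1\times n_2\times\cdots\times n_m}$ and let $\mathcal X^*\in\mathbb R^{n_1\times n_2\times\cdots\times n_m}$ be a minimizer of $\lambda\|\mathcal X\|_{N\ell_1^p}+\frac12\|\mathcal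 X-\mathcal Z\|_F^2$ over all $\mathcal X\in\mathbb R^{n_1\times n_2\times\cdots\times n_m}$ (here the star in $\mathcal X^*$ is only a label). Then there are a t-SVD $\mathcal Z=\mathcal U*_L\mathcal S*_L\mathcal V^*$ and a tensor $\mathcal D\in\mathrm{prox}_{\lambda\|\cdot\|_1^p}(\mathcal S)$ such that $\mathcal X^*=\mathcal U*_L\mathcal D*_L\mathcal V^*$. -/

import Mathlib

open scoped Matrix

namespace LTensor

/-- Index set of the trailing modes `n₃ × ⋯ × n_m` (here `n : Fin r → ℕ`, `r = m - 2`). -/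
abbrev Idx {r : ℕ} (n : Fin r → ℕ) : Type := (k : Fin r) → Fin (n k)

/-- Tensors of size `a × b × n₃ × ⋯ × n_m` with entries in `𝕜`. -/
abbrev Tensor (𝕜 : Type) (a b : ℕ) {r : ℕ} (n : Fin r → ℕ) : Type :=
  Fin a → Fin b → Idx n → 𝕜

/-- A choice of transform matrices `U_{n₃}, …, U_{n_m}`. -/
abbrev TransformMatrices {r : ℕ} (n : Fin r → ℕ) : Type :=
  (k : Fin r) → Matrix (Fin (n k)) (Fin (n k)) ℂ

section Transform

variable {r : ℕ} {n : Fin r → ℕ}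

/-- The Kronecker product of the transform matrices, its rows and columns being indexed by the
multi-indices `(i₃, …, i_m)`. -/
def kron (T : TransformMatrices n) : Matrix (Idx n) (Idx n) ℂ :=
  Matrix.of fun i j => ∏ k, T k (i k) (j k)

/-- The matrix `K` acting on all tubes `A(i, j, :, …, :)` of a tensor. -/
def actTubes (K : Matrix (Idx n) (Idx n) ℂ) {a b : ℕ} (A : Tensor ℂ a b n) : Tensor ℂ a b n :=
  fun i j => K *ᵥ A i j

/-- `L(A) = A ×₃ U_{n₃} ×₄ ⋯ ×_m U_{n_m}`, that is,
`L(A)(i₁, i₂, i₃, …) = ∑_{j₃, …} (∏ₖ U_{nₖ}(iₖ, jₖ)) A(i₁, i₂, j₃, …)`. -/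
def transform (T : TransformMatrices n) {a b : ℕ} (A : Tensor ℂ a b n) : Tensor ℂ a b n :=
  actTubes (kron T) A

/-- `L⁻¹`. -/
noncomputable def invTransform (T : TransformMatrices n) {a b : ℕ} (A : Tensor ℂ a b n) :
    Tensor ℂ a b n :=
  actTubes (kron T)⁻¹ A

/-- The frontal slice `A(:, :, i₃, …, i_m)`. -/
def face {𝕜 : Type} {a b : ℕ} (A : Tensor 𝕜 a b n) (f : Idx n) : Matrix (Fin a) (Fin b) 𝕜 :=
  Matrix.of fun i j => A i j f

/-- The tensor with prescribed frontal slices. -/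
def ofFaces {𝕜 : Type} {a b : ℕ} (F : Idx n → Matrix (Fin a) (Fin b) 𝕜) : Tensor 𝕜 a b n :=
  fun i j f => F f i j

/-- The `L`-based t-product: `L⁻¹` of the facewise product of `L(A)` and `L(B)`. -/
noncomputable def tProd (T : TransformMatrices n) {a b c : ℕ}
    (A : Tensor ℂ a b n) (B : Tensor ℂ b c n) : Tensor ℂ a c n :=
  invTransform T (ofFaces fun f => face (transform T A) f * face (transform T B) f)

/-- The conjugate transpose `A^*`: the frontal slices of `L(A^*)` are the conjugate transposes of
those of `L(A)`. -/
noncomputable def ctrans (T : TransformMatrices n) {a b : ℕ} (A : Tensor ℂ a b n) :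
    Tensor ℂ b a n :=
  invTransform T (ofFaces fun f => (face (transform T A) f)ᴴ)

/-- The identity tensor: all frontal slices of `L(J)` are identity matrices. -/
noncomputable def idTensor (T : TransformMatrices n) (a : ℕ) : Tensor ℂ a a n :=
  invTransform T (ofFaces fun _ => 1)

/-- Orthogonal tensors. -/
def IsOrthogonal (T : TransformMatrices n) {a : ℕ} (A : Tensor ℂ a a n) : Prop :=
  tProd T (ctrans T A) A = idTensor T a ∧ tProd T A (ctrans T A) = idTensor T a

/-- A real tensor regarded as a complex one. -/
def toC {a b : ℕ} (A : Tensor ℝ a b n) : Tensor ℂ a b n := fun i j f => (A i j f : ℂ)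

/-- The Kronecker product of the transform matrices is, up to the factor `ρ`, unitary. -/
def ScaledUnitary (T : TransformMatrices n) (ρ : ℝ) : Prop :=
  kron T * (kron T)ᴴ = (ρ : ℂ) • (1 : Matrix (Idx n) (Idx n) ℂ) ∧
    (kron T)ᴴ * kron T = (ρ : ℂ) • (1 : Matrix (Idx n) (Idx n) ℂ)

/-- The `L`-based t-product is an operation on real tensors. -/
def ProductReal (T : TransformMatrices n) : Prop :=
  ∀ (a b c : ℕ) (A : Tensor ℝ a b n) (B : Tensor ℝ b c n),
    ∃ C : Tensor ℝ a c n, tProd T (toC A) (toC B) = toC C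

/-- A tensor is f-diagonal if each of its frontal slices is diagonal. -/
def IsFDiagonal {a b : ℕ} (A : Tensor ℝ a b n) : Prop :=
  ∀ (i : Fin a) (j : Fin b) (f : Idx n), (i : ℕ) ≠ (j : ℕ) → A i j f = 0

/-- `X = U *_L S *_L V^*` is a t-SVD of the real tensor `X`, with real factors. -/
def IsTSVD (T : TransformMatrices n) {a b : ℕ} (U : Tensor ℝ a a n) (S : Tensor ℝ a b n)
    (V : Tensor ℝ b b n) (X : Tensor ℝ a b n) : Prop :=
  IsOrthogonal T (toC U) ∧ IsOrthogonal T (toC V) ∧ IsFDiagonal S ∧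
    toC X = tProd T (tProd T (toC U) (toC S)) (ctrans T (toC V))

/-- The tensor `ℓ₁` norm. -/
def l1Norm {a b : ℕ} (A : Tensor ℝ a b n) : ℝ := ∑ i, ∑ j, ∑ f, |A i j f|

/-- The squared Frobenius norm. -/
def frobSq {a b : ℕ} (A : Tensor ℝ a b n) : ℝ := ∑ i, ∑ j, ∑ f, A i j f ^ 2

/-- The nuclear `ℓ₁^p` norm of `X`: the value `‖S‖₁^p` for a t-SVD core `S` of `X`. As a tensor has
many t-SVDs and `‖S‖₁` varies among them, the least value is taken. -/
noncomputable def nuclearL1 (T : TransformMatrices n) (p : ℝ) {a b : ℕ} (X : Tensor ℝ a b n) : ℝ :=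
  sInf {t : ℝ | ∃ (U : Tensor ℝ a a n) (S : Tensor ℝ a b n) (V : Tensor ℝ b b n),
    IsTSVD T U S V X ∧ t = l1Norm S ^ p}

/-- The set of minimizers of `½‖D - S‖_F² + lam ‖D‖₁^p` over all real tensors `D`. -/
def proxL1 (lam p : ℝ) {a b : ℕ} (S : Tensor ℝ a b n) : Set (Tensor ℝ a b n) :=
  {D | ∀ D' : Tensor ℝ a b n,
    1 / 2 * frobSq (D - S) + lam * l1Norm D ^ p ≤ 1 / 2 * frobSq (D' - S) + lam * l1Norm D' ^ p}

/-- The set of minimizers of `lam ‖X‖_{Nℓ₁^p} + ½‖X - Z‖_F²` over all real tensors `X`. -/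
def proxNuclear (T : TransformMatrices n) (lam p : ℝ) {a b : ℕ} (Z : Tensor ℝ a b n) :
    Set (Tensor ℝ a b n) :=
  {X | ∀ X' : Tensor ℝ a b n,
    lam * nuclearL1 T p X + 1 / 2 * frobSq (X - Z) ≤
      lam * nuclearL1 T p X' + 1 / 2 * frobSq (X' - Z)}

end Transform

end LTensor

/-! The transform `L` turns `*_L` into slicewise matrix multiplication and orthogonal tensors into
families of unitary matrices, and multiplies squared Frobenius norms by `ρ`. Reality is tracked in
the transform domain: the rows of `kron T` are characters of a commutative algebra with real
structure constants, so complex conjugation permutes them by an involution `s`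
(`ProductReal.exists_involution`). Real tensors are then exactly the `s`-equivariant families of
slices.

By compactness the minimizer `X` has a t-SVD with factors `U₁`, `V₁` and a core `D` of least `ℓ₁`
norm (`exists_isTSVD_nuclearL1_eq`). Let `Y` be `Z` in the coordinates of `U₁`, `V₁`. Replacing
`U₁`, `V₁` by `U₁ Q`, `V₁ R` keeps the core, so the penalty cannot rise; minimality of `X` therefore
says that `∑ re tr (Q D Rᴴ Yᴴ)` is largest at `Q = R = 1`. By polar decomposition, this forces `D
Yᴴ` and `Dᴴ Y` to be Hermitian on every slice (`isHermitian_of_mem_proxNuclear`).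

This Hermitian condition suffices to diagonalize `Y` by unitaries `Q`, `R` with `Qᴴ D R = D`
(`exists_stabilizer_diagonalize`). Hence `U₁ Q` and `V₁ R` give t-SVDs of `X` and `Z`
simultaneously, with cores `D` and `S`. Comparing `X` with the tensors that have an f-diagonal core
`D'` in the same frame shows that `D` beats every such `D'`, and off-diagonal entries of a
competitor only increase the proximal objective. -/

namespace LTensor

/-! ### Linear algebra over `ℝ` or `ℂ`: simultaneous diagonalization and trace maximization. -/

section MatrixLemmas

variable {𝕜 : Type*} [RCLike 𝕜]

/-- A Hermitian matrix that is block diagonal with respect to the fibres of `g` is diagonalized by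
a unitary matrix with the same block structure. -/
theorem exists_unitary_block_diagonalize {α γ : Type*} [Fintype α] [DecidableEq α]
    (g : α → γ) (M : Matrix α α 𝕜) (hM : M.IsHermitian) (hg : ∀ i k, g i ≠ g k → M i k = 0) :
    ∃ (Q : Matrix α α 𝕜) (μ : α → 𝕜), Qᴴ * Q = 1 ∧ (∀ i k, g i ≠ g k → Q i k = 0) ∧
      Qᴴ * M * Q = Matrix.diagonal μ := by
  classical
  -- No finiteness is assumed on `γ`, so the blocks are indexed by the range of `g`.
  let h : α → Set.range g := fun i => ⟨g i, i, rfl⟩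
  have hh : ∀ {i k}, g i ≠ g k ↔ h i ≠ h k := fun {i k} => by
    rw [Ne, Ne, Subtype.ext_iff]
  let e : (Σ y, {x // h x = y}) ≃ α := Equiv.sigmaFiberEquiv h
  let N : (y : Set.range g) → Matrix {x // h x = y} {x // h x = y} 𝕜 := fun y =>
    M.submatrix Subtype.val Subtype.val
  have hN : ∀ y, (N y).IsHermitian := fun y => hM.submatrix _
  have hMN : M.submatrix e e = Matrix.blockDiagonal' N := by
    ext ⟨y, i, hi⟩ ⟨z, k, hk⟩
    by_cases hyz : y = z
    · subst hyz
      simp [N, e, Matrix.blockDiagonal'_apply_eq]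
    · rw [Matrix.blockDiagonal'_apply_ne _ _ _ hyz]
      apply hg
      rw [hh]
      simpa [e, hi, hk] using hyz
  let U : (y : Set.range g) → Matrix {x // h x = y} {x // h x = y} 𝕜 := fun y =>
    ((hN y).eigenvectorUnitary : Matrix _ _ 𝕜)
  have hU : ∀ y, (U y)ᴴ * U y = 1 := fun y => Unitary.coe_star_mul_self (hN y).eigenvectorUnitary
  have hD : ∀ y, (U y)ᴴ * N y * U y = Matrix.diagonal (RCLike.ofReal ∘ (hN y).eigenvalues) := by
    intro y
    have := (hN y).conjStarAlgAut_star_eigenvectorUnitary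
    rw [Unitary.conjStarAlgAut_apply] at this
    simpa [Matrix.star_eq_conjTranspose] using this
  let Q : Matrix α α 𝕜 := (Matrix.blockDiagonal' U).submatrix e.symm e.symm
  refine ⟨Q, fun i => ((hN _).eigenvalues (e.symm i).2 : 𝕜), ?_, ?_, ?_⟩
  · rw [Matrix.conjTranspose_submatrix, Matrix.submatrix_mul_equiv,
      Matrix.blockDiagonal'_conjTranspose, ← Matrix.blockDiagonal'_mul]
    simp only [hU]
    have : (Matrix.blockDiagonal' fun y : Set.range g =>
      (1 : Matrix {x // h x = y} {x // h x = y} 𝕜)) = 1 := Matrix.blockDiagonal'_one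
    rw [this, Matrix.submatrix_one_equiv]
  · intro i k hik
    rw [hh] at hik
    exact Matrix.blockDiagonal'_apply_ne U (e.symm i).2 (e.symm k).2 hik
  · have hM' : M = (Matrix.blockDiagonal' N).submatrix e.symm e.symm := by
      rw [← hMN]; ext; simp
    rw [hM', Matrix.conjTranspose_submatrix, Matrix.submatrix_mul_equiv,
      Matrix.submatrix_mul_equiv,
      Matrix.blockDiagonal'_conjTranspose, ← Matrix.blockDiagonal'_mul,
      ← Matrix.blockDiagonal'_mul]
    simp only [hD]
    rw [Matrix.blockDiagonal'_diagonal]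
    ext i k
    simp [Matrix.diagonal_apply, Matrix.submatrix_apply]

/-- Orthogonal columns are nonnegative multiples of prescribed columns of some unitary matrix. -/
theorem exists_unitary_columns {α β : Type*} [Fintype α] [Fintype β] [DecidableEq β]
    (e : α ↪ β) (V : Matrix β α 𝕜) (hV : ∀ i k, i ≠ k → (Vᴴ * V) i k = 0) :
    ∃ (R : Matrix β β 𝕜) (c : α → ℝ), Rᴴ * R = 1 ∧ (∀ i, 0 ≤ c i) ∧
      (∀ i, ((c i ^ 2 : ℝ) : 𝕜) = (Vᴴ * V) i i) ∧ ∀ l i, V l i = c i * R l (e i) := by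
  classical
  let w : α → EuclideanSpace 𝕜 β := fun i => WithLp.toLp 2 fun l => V l i
  have hw : ∀ i k, inner 𝕜 (w i) (w k) = (Vᴴ * V) i k := by
    intro i k
    simp [w, EuclideanSpace.inner_eq_star_dotProduct, dotProduct, Matrix.mul_apply, mul_comm]
  -- The normalized nonzero columns are placed at the positions `e i` and completed to an
  -- orthonormal basis. A zero column leaves its basis vector free and gets the coefficient `0`.
  let f : β → EuclideanSpace 𝕜 β := Function.extend e (fun i => ((‖w i‖⁻¹ : ℝ) : 𝕜) • w i) 0
  have hf : ∀ i, f (e i) = ((‖w i‖⁻¹ : ℝ) : 𝕜) • w i := fun i =>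
    e.injective.extend_apply _ _ i
  let s : Set β := e '' {i | w i ≠ 0}
  have hs : Orthonormal 𝕜 (s.domRestrict f) := by
    constructor
    · rintro ⟨_, i, hi, rfl⟩
      have hi' : ‖w i‖ ≠ 0 := norm_ne_zero_iff.mpr hi
      simp only [Set.domRestrict_apply, hf, norm_smul, RCLike.norm_ofReal, abs_inv, abs_norm]
      exact inv_mul_cancel₀ hi'
    · rintro ⟨_, i, hi, rfl⟩ ⟨_, k, hk, rfl⟩ hne
      have hik : i ≠ k := by rintro rfl; exact hne rfl
      simp only [Set.domRestrict_apply, hf, inner_smul_left, inner_smul_right, hw, hV i k hik,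
        mul_zero]
  obtain ⟨b, hb⟩ := hs.exists_orthonormalBasis_extension_of_card_eq (by simp)
  refine ⟨Matrix.of fun l j => b j l, fun i => ‖w i‖, ?_, fun i => norm_nonneg _, ?_, ?_⟩
  · ext i k
    have := orthonormal_iff_ite.mp b.orthonormal i k
    rw [Matrix.one_apply, ← this]
    simp [EuclideanSpace.inner_eq_star_dotProduct, dotProduct, Matrix.mul_apply, mul_comm]
  · intro i
    rw [← hw, inner_self_eq_norm_sq_to_K]
    push_cast; rfl
  · intro l i
    by_cases hi : w i = 0
    · have : V l i = w i l := rfl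
      simp [this, hi]
    · have hi' : (‖w i‖ : 𝕜) ≠ 0 := by simpa using hi
      rw [Matrix.of_apply, hb (e i) ⟨i, hi, rfl⟩, hf]
      simp only [PiLp.smul_apply, smul_eq_mul]
      rw [← mul_assoc]
      push_cast
      rw [mul_inv_cancel₀ hi', one_mul]

/-- If `D` is diagonal with respect to `e` and `D Zᴴ`, `Dᴴ Z` are Hermitian, then `Z` can be
diagonalized by a pair of unitary matrices that fixes `D`. -/
theorem exists_stabilizer_diagonalize {α β : Type*} [Fintype α] [Fintype β] [DecidableEq α]
    [DecidableEq β] (e : α ↪ β) (D Z : Matrix α β 𝕜) (hD : ∀ i j, j ≠ e i → D i j = 0)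
    (h₁ : (D * Zᴴ).IsHermitian) (h₂ : (Dᴴ * Z).IsHermitian) :
    ∃ (Q : Matrix α α 𝕜) (R : Matrix β β 𝕜), Qᴴ * Q = 1 ∧ Rᴴ * R = 1 ∧ Qᴴ * D * R = D ∧
      ∀ i j, j ≠ e i → (Qᴴ * Z * R) i j = 0 := by
  classical
  set d : α → 𝕜 := fun i => D i (e i) with hd
  have hD' : ∀ i j, D i j = if j = e i then d i else 0 := by
    intro i j
    split_ifs with h
    · rw [h]
    · exact hD i j h
  have hd0 : ∀ i, d i = 0 → ∀ j, D i j = 0 := by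
    intro i hi j; rw [hD', hi]; simp
  set g : α → 𝕜 := fun i => d i * star (d i) with hg
  have hg0 : ∀ i, g i = 0 ↔ d i = 0 := by intro i; simp [hg]
  have hDD : D * Dᴴ = Matrix.diagonal g := by
    ext i k
    simp only [Matrix.mul_apply, Matrix.conjTranspose_apply, hD' i, Matrix.diagonal_apply]
    simp only [ite_mul, zero_mul, Finset.sum_ite_eq', Finset.mem_univ, if_true]
    split_ifs with h
    · subst h; simp [hg, hd]
    · rw [hD k (e i) (fun h' => h (e.injective h'))]; simp
  set B : Matrix α α 𝕜 := D * Zᴴ with hB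
  have hBH : Z * Dᴴ = B := by
    have := h₁.eq
    rw [hB, Matrix.conjTranspose_mul, Matrix.conjTranspose_conjTranspose] at this
    exact this
  have h₂' : Zᴴ * D = Dᴴ * Z := by
    have := h₂.eq
    rw [Matrix.conjTranspose_mul, Matrix.conjTranspose_conjTranspose] at this
    exact this
  have hBsymm : ∀ i k, B i k = star (B k i) := fun i k => (h₁.apply i k).symm
  have hB0 : ∀ i, d i = 0 → ∀ k, B i k = 0 := by
    intro i hi k
    rw [hB, Matrix.mul_apply]
    exact Finset.sum_eq_zero fun j _ => by rw [hd0 i hi j, zero_mul]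
  have hB0' : ∀ k, d k = 0 → ∀ i, B i k = 0 := by
    intro k hk i
    rw [hBsymm, hB0 k hk, star_zero]
  -- Both Hermitian hypotheses enter here. Since `B` commutes with `D Dᴴ = diag g`, it is block
  -- diagonal along the level sets of `|d i|²`.
  have hBg : Matrix.diagonal g * B = B * Matrix.diagonal g := by
    calc Matrix.diagonal g * B = D * Dᴴ * (Z * Dᴴ) := by rw [hDD, hBH]
      _ = D * (Dᴴ * Z) * Dᴴ := by simp only [Matrix.mul_assoc]
      _ = D * (Zᴴ * D) * Dᴴ := by rw [h₂']
      _ = D * Zᴴ * (D * Dᴴ) := by simp only [Matrix.mul_assoc]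
      _ = B * Matrix.diagonal g := by rw [hDD]
  have hBg' : ∀ i k, g i ≠ g k → B i k = 0 := by
    intro i k hik
    have := congrFun (congrFun hBg i) k
    rw [Matrix.diagonal_mul, Matrix.mul_diagonal, mul_comm, ← sub_eq_zero, ← mul_sub] at this
    exact (mul_eq_zero.mp this).resolve_right (sub_ne_zero.mpr hik)
  -- On the block `d = 0` the matrix `B` vanishes and says nothing about `Z`, so `Z Zᴴ` is used
  -- there instead. A single block unitary `Q` then diagonalizes `B` and the zero block of `Z Zᴴ`.
  let M : Matrix α α 𝕜 := Matrix.of fun i k =>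
    if d i = 0 ∧ d k = 0 then (Z * Zᴴ) i k else B i k
  have hC : (Z * Zᴴ).IsHermitian := Matrix.isHermitian_mul_conjTranspose_self Z
  have hM : M.IsHermitian := by
    ext i k
    simp only [M, Matrix.conjTranspose_apply, Matrix.of_apply, and_comm (a := d k = 0)]
    split_ifs
    · exact hC.apply i k
    · exact (hBsymm i k).symm
  have hMg : ∀ i k, g i ≠ g k → M i k = 0 := by
    intro i k hik
    simp only [M, Matrix.of_apply]
    split_ifs with h
    · exact absurd ((hg0 i).2 h.1 |>.trans ((hg0 k).2 h.2).symm) hik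
    · exact hBg' i k hik
  obtain ⟨Q, μ, hQ, hQg, hQM⟩ := exists_unitary_block_diagonalize g M hM hMg
  have hQ' : Q * Qᴴ = 1 := mul_eq_one_comm.mp hQ
  have hMQ : M * Q = Q * Matrix.diagonal μ := by
    rw [← hQM, Matrix.mul_assoc, ← Matrix.mul_assoc, hQ', Matrix.one_mul]
  have hgQ : Matrix.diagonal g * Q = Q * Matrix.diagonal g := by
    ext i k
    rw [Matrix.diagonal_mul, Matrix.mul_diagonal]
    by_cases h : g i = g k
    · rw [h, mul_comm]
    · rw [hQg i k h]; simp
  have hQ0 : ∀ i k, d i = 0 → d k ≠ 0 → Q i k = 0 := by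
    intro i k hi hk
    apply hQg
    rw [(hg0 i).2 hi]
    exact fun h => hk ((hg0 k).1 h.symm)
  have hQ0' : ∀ i k, d i ≠ 0 → d k = 0 → Q i k = 0 := by
    intro i k hi hk
    apply hQg
    rw [(hg0 k).2 hk]
    exact fun h => hi ((hg0 i).1 h)
  let ν : α → 𝕜 := fun i => if d i = 0 then 0 else μ i
  have hBQ : B * Q = Q * Matrix.diagonal ν := by
    ext i l
    rw [Matrix.mul_diagonal]
    by_cases hl : d l = 0
    · simp only [ν, hl, if_true, mul_zero, Matrix.mul_apply]
      refine Finset.sum_eq_zero fun k _ => ?_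
      by_cases hk : d k = 0
      · rw [hB0' k hk, zero_mul]
      · rw [hQ0' k l hk hl, mul_zero]
    · have := congrFun (congrFun hMQ i) l
      rw [Matrix.mul_diagonal] at this
      simp only [ν, hl, if_false]
      rw [← this, Matrix.mul_apply, Matrix.mul_apply]
      refine Finset.sum_congr rfl fun k _ => ?_
      by_cases hk : d k = 0
      · rw [hQ0 k l hk hl, mul_zero, mul_zero]
      · simp [M, hk]
  have hQC : ∀ i l, d i = 0 → d l = 0 → (Qᴴ * (Z * Zᴴ) * Q) i l = Matrix.diagonal μ i l := by
    intro i l hi hl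
    rw [← hQM]
    simp only [Matrix.mul_apply (M := _ * _) (N := Q), Matrix.mul_apply (M := Qᴴ)]
    refine Finset.sum_congr rfl fun k _ => ?_
    by_cases hk : d k = 0
    · congr 1
      refine Finset.sum_congr rfl fun m _ => ?_
      by_cases hm : d m = 0
      · simp [M, hk, hm]
      · rw [Matrix.conjTranspose_apply, hQ0' m i hm hi]; simp
    · rw [hQ0' k l hk hl]; simp
  have hDQ0 : ∀ l i, d i = 0 → (Dᴴ * Q) l i = 0 := by
    intro l i hi
    rw [Matrix.mul_apply]
    refine Finset.sum_eq_zero fun k _ => ?_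
    by_cases hk : d k = 0
    · rw [Matrix.conjTranspose_apply, hd0 k hk]; simp
    · rw [hQ0' k i hk hi, mul_zero]
  have hQBQ : Qᴴ * B * Q = Matrix.diagonal ν := by
    rw [Matrix.mul_assoc, hBQ, ← Matrix.mul_assoc, hQ, Matrix.one_mul]
  have hDQ : (Dᴴ * Q)ᴴ * (Dᴴ * Q) = Matrix.diagonal g := by
    rw [Matrix.conjTranspose_mul, Matrix.conjTranspose_conjTranspose]
    calc Qᴴ * D * (Dᴴ * Q) = Qᴴ * ((D * Dᴴ) * Q) := by simp only [Matrix.mul_assoc]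
      _ = _ := by rw [hDD, hgQ, ← Matrix.mul_assoc, hQ, Matrix.one_mul]
  have hDZQ : (Dᴴ * Q)ᴴ * (Zᴴ * Q) = Matrix.diagonal ν := by
    rw [Matrix.conjTranspose_mul, Matrix.conjTranspose_conjTranspose, ← hQBQ, hB]
    simp only [Matrix.mul_assoc]
  have hZDQ : (Zᴴ * Q)ᴴ * (Dᴴ * Q) = Matrix.diagonal ν := by
    rw [Matrix.conjTranspose_mul, Matrix.conjTranspose_conjTranspose, ← hQBQ, ← hBH]
    simp only [Matrix.mul_assoc]
  have hZZQ : (Zᴴ * Q)ᴴ * (Zᴴ * Q) = Qᴴ * (Z * Zᴴ) * Q := by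
    rw [Matrix.conjTranspose_mul, Matrix.conjTranspose_conjTranspose]
    simp only [Matrix.mul_assoc]
  -- These columns should be those of `R`: where `d i ≠ 0` they are dictated by `Qᴴ D R = D`, and
  -- elsewhere by the rows of `Qᴴ Z`. Their Gram matrix is diagonal because `g`, `ν` and `μ` are, on
  -- the respective blocks.
  let V : Matrix β α 𝕜 := Matrix.of fun l i =>
    if d i = 0 then (Zᴴ * Q) l i else (star (d i))⁻¹ * (Dᴴ * Q) l i
  have hVV : ∀ i k, (Vᴴ * V) i k =
      if d i = 0 then
        if d k = 0 then Matrix.diagonal μ i k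
        else (star (d k))⁻¹ * Matrix.diagonal ν i k
      else
        if d k = 0 then (d i)⁻¹ * Matrix.diagonal ν i k
        else (d i)⁻¹ * ((star (d k))⁻¹ * Matrix.diagonal g i k) := by
    intro i k
    by_cases hi : d i = 0 <;> by_cases hk : d k = 0
    · rw [if_pos hi, if_pos hk, ← hQC i k hi hk, ← hZZQ, Matrix.mul_apply, Matrix.mul_apply]
      simp [V, hi, hk]
    · rw [if_pos hi, if_neg hk, ← hZDQ, Matrix.mul_apply, Matrix.mul_apply, Finset.mul_sum]
      refine Finset.sum_congr rfl fun l _ => ?_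
      simp only [Matrix.conjTranspose_apply, V, Matrix.of_apply, hi, hk, if_true, if_false]
      ring
    · rw [if_neg hi, if_pos hk, ← hDZQ, Matrix.mul_apply, Matrix.mul_apply, Finset.mul_sum]
      refine Finset.sum_congr rfl fun l _ => ?_
      simp only [Matrix.conjTranspose_apply, V, Matrix.of_apply, hi, hk, if_true, if_false,
        star_mul', star_inv₀, star_star]
      ring
    · rw [if_neg hi, if_neg hk, ← hDQ, Matrix.mul_apply, Matrix.mul_apply, Finset.mul_sum,
        Finset.mul_sum]
      refine Finset.sum_congr rfl fun l _ => ?_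
      simp only [Matrix.conjTranspose_apply, V, Matrix.of_apply, hi, hk, if_false,
        star_mul', star_inv₀, star_star]
      ring
  have hVne : ∀ i k, i ≠ k → (Vᴴ * V) i k = 0 := by
    intro i k hik
    rw [hVV]
    simp [Matrix.diagonal_apply_ne _ hik]
  obtain ⟨R, c, hR, hc, hcV, hVR⟩ := exists_unitary_columns e V hVne
  have hc1 : ∀ i, d i ≠ 0 → c i = 1 := by
    intro i hi
    have h := hcV i
    have hi' : star (d i) ≠ 0 := star_ne_zero.mpr hi
    rw [hVV, if_neg hi, if_neg hi, Matrix.diagonal_apply_eq, hg] at h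
    have h1 : (d i)⁻¹ * ((star (d i))⁻¹ * (d i * star (d i))) = 1 := by field_simp
    rw [h1] at h
    have h2 : c i ^ 2 = 1 := by exact_mod_cast h
    nlinarith [hc i]
  have hDR : ∀ l i, (Dᴴ * Q) l i = star (d i) * R l (e i) := by
    intro l i
    by_cases hi : d i = 0
    · rw [hDQ0 l i hi, hi]; simp
    · have h := hVR l i
      rw [hc1 i hi] at h
      simp only [V, Matrix.of_apply, hi, if_false, RCLike.ofReal_one, one_mul] at h
      rw [← h, mul_inv_cancel_left₀ (star_ne_zero.mpr hi)]
  -- Where `g i ≠ 0`, this makes the column `i` of `Zᴴ Q` a multiple of that of `Dᴴ Q`, hence of the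
  -- column `e i` of `R`.
  have hZg : Zᴴ * Q * Matrix.diagonal g = Dᴴ * Q * Matrix.diagonal ν := by
    calc Zᴴ * Q * Matrix.diagonal g = (Zᴴ * D) * Dᴴ * Q := by
          rw [Matrix.mul_assoc, ← hgQ, ← hDD]; simp only [Matrix.mul_assoc]
      _ = Dᴴ * ((Z * Dᴴ) * Q) := by rw [h₂']; simp only [Matrix.mul_assoc]
      _ = _ := by rw [hBH, hBQ]; simp only [Matrix.mul_assoc]
  have hZR : ∃ τ : α → 𝕜, ∀ l i, (Zᴴ * Q) l i = τ i * R l (e i) := by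
    refine ⟨fun i => if d i = 0 then c i else (g i)⁻¹ * (ν i * star (d i)), fun l i => ?_⟩
    by_cases hi : d i = 0
    · have h := hVR l i
      simp only [V, Matrix.of_apply, hi, if_true] at h
      simp only [h, hi, if_true]
    · have h := congrFun (congrFun hZg l) i
      rw [Matrix.mul_diagonal, Matrix.mul_diagonal, hDR] at h
      have hgi : g i ≠ 0 := fun h => hi ((hg0 i).1 h)
      simp only [hi, if_false]
      field_simp
      rw [h]; ring
  obtain ⟨τ, hτ⟩ := hZR
  have key : ∀ (A : Matrix β α 𝕜) (t : α → 𝕜), (∀ l i, A l i = t i * R l (e i)) →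
      ∀ i j, (Aᴴ * R) i j = if j = e i then star (t i) else 0 := by
    intro A t hA i j
    have h := congrFun (congrFun hR (e i)) j
    rw [Matrix.mul_apply, Matrix.one_apply] at h
    rw [Matrix.mul_apply]
    simp only [Matrix.conjTranspose_apply, hA, star_mul', mul_assoc] at h ⊢
    rw [← Finset.mul_sum, h]
    simp [eq_comm]
  refine ⟨Q, R, hQ, hR, ?_, ?_⟩
  · ext i j
    have h := key _ _ hDR i j
    rw [Matrix.conjTranspose_mul, Matrix.conjTranspose_conjTranspose] at h
    rw [h, hD', star_star]
  · intro i j hij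
    have h := key _ _ hτ i j
    rw [Matrix.conjTranspose_mul, Matrix.conjTranspose_conjTranspose] at h
    rw [h, if_neg hij]

/-- The version of `exists_stabilizer_diagonalize` for rectangular matrices. -/
theorem exists_stabilizer_diagonalize_fin {a b : ℕ} (D Z : Matrix (Fin a) (Fin b) 𝕜)
    (hD : ∀ (i : Fin a) (j : Fin b), (i : ℕ) ≠ j → D i j = 0)
    (h₁ : (D * Zᴴ).IsHermitian) (h₂ : (Dᴴ * Z).IsHermitian) :
    ∃ (Q : Matrix (Fin a) (Fin a) 𝕜) (R : Matrix (Fin b) (Fin b) 𝕜), Qᴴ * Q = 1 ∧ Rᴴ * R = 1 ∧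
      Qᴴ * D * R = D ∧ ∀ (i : Fin a) (j : Fin b), (i : ℕ) ≠ j → (Qᴴ * Z * R) i j = 0 := by
  rcases le_total a b with hab | hab
  · have he : ∀ (i : Fin a) (j : Fin b), j ≠ Fin.castLEEmb hab i ↔ (i : ℕ) ≠ j := by
      intro i j; simp [Fin.ext_iff, eq_comm]
    obtain ⟨Q, R, hQ, hR, h, h'⟩ := exists_stabilizer_diagonalize (Fin.castLEEmb hab) D Z
      (fun i j hij => hD i j ((he i j).1 hij)) h₁ h₂
    exact ⟨Q, R, hQ, hR, h, fun i j hij => h' i j ((he i j).2 hij)⟩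
  · have he : ∀ (i : Fin b) (j : Fin a), j ≠ Fin.castLEEmb hab i ↔ (j : ℕ) ≠ i := by
      intro i j; simp [Fin.ext_iff]
    obtain ⟨Q, R, hQ, hR, h, h'⟩ := exists_stabilizer_diagonalize (Fin.castLEEmb hab) Dᴴ Zᴴ
      (fun i j hij => by rw [Matrix.conjTranspose_apply, hD j i ((he i j).1 hij), star_zero])
      (by
        have := h₂.eq
        rw [Matrix.conjTranspose_mul, Matrix.conjTranspose_conjTranspose] at this
        simp only [Matrix.IsHermitian, Matrix.conjTranspose_mul,
          Matrix.conjTranspose_conjTranspose, this])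
      (by
        have := h₁.eq
        rw [Matrix.conjTranspose_mul, Matrix.conjTranspose_conjTranspose] at this
        simp only [Matrix.IsHermitian, Matrix.conjTranspose_mul,
          Matrix.conjTranspose_conjTranspose, this])
    refine ⟨R, Q, hR, hQ, ?_, fun i j hij => ?_⟩
    · have := congrArg Matrix.conjTranspose h
      simpa [Matrix.conjTranspose_mul, Matrix.mul_assoc] using this
    · have h2 : Rᴴ * Z * Q = (Qᴴ * Zᴴ * R)ᴴ := by simp [Matrix.conjTranspose_mul, Matrix.mul_assoc]
      rw [h2, Matrix.conjTranspose_apply, h' j i ((he j i).2 hij), star_zero]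

/-- Polar decomposition. -/
theorem exists_polar {α : Type*} [Fintype α] [DecidableEq α] (Y : Matrix α α 𝕜) :
    ∃ Q B : Matrix α α 𝕜, Qᴴ * Q = 1 ∧ Y = Qᴴ * (Bᴴ * B) := by
  classical
  -- With `D = 0` the Hermitian hypotheses are void and what remains is a singular value
  -- decomposition up to phases; the phases `φ` are moved into the unitary factor below.
  obtain ⟨P, R, hP, hR, -, h⟩ := exists_stabilizer_diagonalize (Function.Embedding.refl α)
    (0 : Matrix α α 𝕜) Y (by simp) (by simp) (by simp)
  set s : α → 𝕜 := fun i => (Pᴴ * Y * R) i i with hs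
  have hS : Pᴴ * Y * R = Matrix.diagonal s := by
    ext i j
    by_cases hij : i = j
    · subst hij; simp [hs]
    · rw [Matrix.diagonal_apply_ne _ hij]; exact h i j (Ne.symm hij)
  have hP' : P * Pᴴ = 1 := mul_eq_one_comm.mp hP
  have hR' : R * Rᴴ = 1 := mul_eq_one_comm.mp hR
  have hY : Y = P * Matrix.diagonal s * Rᴴ := by
    rw [← hS]
    calc Y = (P * Pᴴ) * Y * (R * Rᴴ) := by rw [hP', hR']; simp
      _ = _ := by simp only [Matrix.mul_assoc]
  have hφ : ∀ z : 𝕜, ∃ w : 𝕜, star w * w = 1 ∧ z = w * (‖z‖ : 𝕜) := by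
    intro z
    by_cases hz : z = 0
    · exact ⟨1, by simp, by simp [hz]⟩
    · have hz' : (‖z‖ : 𝕜) ≠ 0 := by simpa using hz
      refine ⟨z / ‖z‖, ?_, by field_simp⟩
      have hzz : star z * z = (‖z‖ : 𝕜) ^ 2 := RCLike.conj_mul z
      have h3 : star (‖z‖ : 𝕜) = ‖z‖ := RCLike.conj_ofReal _
      rw [star_div₀, h3, div_mul_div_comm, hzz]
      field_simp
  choose φ hφ1 hφ2 using fun i => hφ (s i)
  refine ⟨R * (Matrix.diagonal φ)ᴴ * Pᴴ,
    Matrix.diagonal (fun i => (Real.sqrt ‖s i‖ : 𝕜)) * Rᴴ, ?_, ?_⟩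
  · simp only [Matrix.conjTranspose_mul, Matrix.conjTranspose_conjTranspose]
    have h1 : Matrix.diagonal φ * (Matrix.diagonal φ)ᴴ = 1 := by
      rw [Matrix.diagonal_conjTranspose, Matrix.diagonal_mul_diagonal, ← Matrix.diagonal_one]
      congr 1; funext i; rw [mul_comm]; exact hφ1 i
    calc P * (Matrix.diagonal φ * Rᴴ) * (R * (Matrix.diagonal φ)ᴴ * Pᴴ)
        = P * (Matrix.diagonal φ * (Rᴴ * R) * (Matrix.diagonal φ)ᴴ) * Pᴴ := by
          simp only [Matrix.mul_assoc]
      _ = 1 := by rw [hR, Matrix.mul_one, h1, Matrix.mul_one, hP']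
  · have h1 : Matrix.diagonal s = Matrix.diagonal φ *
        ((Matrix.diagonal (fun i => (Real.sqrt ‖s i‖ : 𝕜)))ᴴ *
          Matrix.diagonal (fun i => (Real.sqrt ‖s i‖ : 𝕜))) := by
      rw [Matrix.diagonal_conjTranspose, Matrix.diagonal_mul_diagonal,
        Matrix.diagonal_mul_diagonal]
      congr 1; funext i
      have h3 : star (Real.sqrt ‖s i‖ : 𝕜) = Real.sqrt ‖s i‖ := RCLike.conj_ofReal _
      rw [Pi.star_apply, h3, ← RCLike.ofReal_mul, Real.mul_self_sqrt (norm_nonneg _)]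
      exact hφ2 i
    rw [hY, h1]
    simp only [Matrix.conjTranspose_mul, Matrix.conjTranspose_conjTranspose]
    calc _ = P * (Matrix.diagonal φ * (1 * ((Matrix.diagonal (fun i => (Real.sqrt ‖s i‖ : 𝕜)))ᴴ *
          Matrix.diagonal (fun i => (Real.sqrt ‖s i‖ : 𝕜))))) * Rᴴ := by rw [Matrix.one_mul]
      _ = _ := by rw [← hR]; simp only [Matrix.mul_assoc]

/-- Some unitary `Q` maximizes `re tr (Q Y)`, and strictly increases it unless `Y` is
Hermitian. -/
theorem exists_unitary_trace_ge {α : Type*} [Fintype α] [DecidableEq α] (Y : Matrix α α 𝕜) :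
    ∃ Q : Matrix α α 𝕜, Qᴴ * Q = 1 ∧ RCLike.re Y.trace ≤ RCLike.re (Q * Y).trace ∧
      (RCLike.re (Q * Y).trace ≤ RCLike.re Y.trace → Y.IsHermitian) := by
  obtain ⟨Q, B, hQ, hY⟩ := exists_polar Y
  have hQ' : Q * Qᴴ = 1 := mul_eq_one_comm.mp hQ
  have hH : Q * Y = Bᴴ * B := by rw [hY, ← Matrix.mul_assoc, hQ', Matrix.one_mul]
  -- As `Q Y = Bᴴ B`, the squared Frobenius norm of `N` is twice the gain in trace. If there is no
  -- gain, then `B Q = B`, and so `Y = Qᴴ Bᴴ B = Bᴴ B`.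
  set N := B * (1 - Q) with hN
  have hNN : RCLike.re (Nᴴ * N).trace =
      2 * (RCLike.re (Q * Y).trace - RCLike.re Y.trace) := by
    have h1 : Nᴴ * N = Bᴴ * B - Qᴴ * (Bᴴ * B) - (Qᴴ * (Bᴴ * B))ᴴ + Qᴴ * ((Bᴴ * B) * Q) := by
      rw [hN]
      simp only [Matrix.conjTranspose_mul, Matrix.conjTranspose_sub,
        Matrix.conjTranspose_conjTranspose, Matrix.sub_mul, Matrix.mul_sub,
        Matrix.mul_one, Matrix.mul_assoc]
      abel
    have h2 : (Qᴴ * ((Bᴴ * B) * Q)).trace = (Bᴴ * B).trace := by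
      rw [Matrix.trace_mul_comm, Matrix.mul_assoc, hQ', Matrix.mul_one]
    have h3 : RCLike.re ((Qᴴ * (Bᴴ * B))ᴴ).trace = RCLike.re Y.trace := by
      rw [Matrix.trace_conjTranspose, ← hY]; exact RCLike.conj_re _
    rw [h1, Matrix.trace_add, Matrix.trace_sub, Matrix.trace_sub, h2, map_add, map_sub, map_sub,
      h3, ← hY, hH]
    ring
  have hsum : RCLike.re (Nᴴ * N).trace = ∑ i, ∑ l, ‖N l i‖ ^ 2 := by
    simp only [Matrix.trace, Matrix.diag_apply, Matrix.mul_apply, Matrix.conjTranspose_apply,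
      map_sum]
    refine Finset.sum_congr rfl fun i _ => Finset.sum_congr rfl fun l _ => ?_
    have : star (N l i) * N l i = (‖N l i‖ : 𝕜) ^ 2 := RCLike.conj_mul _
    rw [this, ← RCLike.ofReal_pow, RCLike.ofReal_re]
  have hpos : 0 ≤ RCLike.re (Nᴴ * N).trace := by rw [hsum]; positivity
  refine ⟨Q, hQ, by linarith, fun hle => ?_⟩
  have h0 : RCLike.re (Nᴴ * N).trace = 0 := le_antisymm (by linarith) hpos
  have hN0 : N = 0 := by
    ext l i
    rw [hsum, Finset.sum_eq_zero_iff_of_nonneg (fun _ _ => by positivity)] at h0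
    have h1 := h0 i (Finset.mem_univ _)
    rw [Finset.sum_eq_zero_iff_of_nonneg (fun _ _ => by positivity)] at h1
    simpa using h1 l (Finset.mem_univ _)
  have hBQ : B * Q = B := by
    rw [hN, Matrix.mul_sub, Matrix.mul_one, sub_eq_zero] at hN0
    exact hN0.symm
  have hQB : Qᴴ * Bᴴ = Bᴴ := by rw [← Matrix.conjTranspose_mul, hBQ]
  rw [hY, ← Matrix.mul_assoc, hQB]
  exact Matrix.isHermitian_conjTranspose_mul_self B

end MatrixLemmas

/-! ### The transform domain and its real structure. -/

section Spectrum

variable {r : ℕ} {n : Fin r → ℕ}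

/-- The frontal slices of `L(A)`. -/
def spec (T : TransformMatrices n) {a b : ℕ} (A : Tensor ℂ a b n) (f : Idx n) :
    Matrix (Fin a) (Fin b) ℂ :=
  face (transform T A) f

theorem spec_apply (T : TransformMatrices n) {a b : ℕ} (A : Tensor ℂ a b n) (f : Idx n)
    (i : Fin a) (j : Fin b) : spec T A f i j = ∑ g, kron T f g * A i j g := rfl

variable {T : TransformMatrices n} {ρ : ℝ}

theorem ScaledUnitary.kron_mul_inv (hρ : 0 < ρ) (hT : ScaledUnitary T ρ) :
    kron T * (kron T)⁻¹ = 1 := by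
  have hρ' : (ρ : ℂ) ≠ 0 := by exact_mod_cast hρ.ne'
  have h : kron T * ((ρ : ℂ)⁻¹ • (kron T)ᴴ) = 1 := by
    rw [Matrix.mul_smul, hT.1, smul_smul, inv_mul_cancel₀ hρ', one_smul]
  rw [Matrix.inv_eq_right_inv h, h]

theorem spec_invTransform (hK : kron T * (kron T)⁻¹ = 1) {a b : ℕ}
    (F : Idx n → Matrix (Fin a) (Fin b) ℂ) (f : Idx n) :
    spec T (invTransform T (ofFaces F)) f = F f := by
  ext i j
  change (kron T *ᵥ ((kron T)⁻¹ *ᵥ fun g => F g i j)) f = _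
  rw [Matrix.mulVec_mulVec, hK, Matrix.one_mulVec]

theorem spec_injective (hK : kron T * (kron T)⁻¹ = 1) {a b : ℕ} {A B : Tensor ℂ a b n}
    (h : ∀ f, spec T A f = spec T B f) : A = B := by
  funext i j
  have h' : kron T *ᵥ A i j = kron T *ᵥ B i j := by
    funext f
    exact congrFun (congrFun (h f) i) j
  have := congrArg (fun v => (kron T)⁻¹ *ᵥ v) h'
  simpa only [Matrix.mulVec_mulVec, mul_eq_one_comm.mp hK, Matrix.one_mulVec] using this

theorem spec_tProd (hK : kron T * (kron T)⁻¹ = 1) {a b c : ℕ}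
    (A : Tensor ℂ a b n) (B : Tensor ℂ b c n) (f : Idx n) :
    spec T (tProd T A B) f = spec T A f * spec T B f :=
  spec_invTransform hK _ f

theorem spec_ctrans (hK : kron T * (kron T)⁻¹ = 1) {a b : ℕ}
    (A : Tensor ℂ a b n) (f : Idx n) : spec T (ctrans T A) f = (spec T A f)ᴴ :=
  spec_invTransform hK _ f

theorem spec_idTensor (hK : kron T * (kron T)⁻¹ = 1) (a : ℕ) (f : Idx n) :
    spec T (idTensor T a) f = 1 :=
  spec_invTransform hK _ f

theorem isOrthogonal_iff (hK : kron T * (kron T)⁻¹ = 1) {a : ℕ} (A : Tensor ℂ a a n) :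
    IsOrthogonal T A ↔ ∀ f, (spec T A f)ᴴ * spec T A f = 1 := by
  constructor
  · intro h f
    rw [← spec_ctrans hK, ← spec_tProd hK, h.1, spec_idTensor hK]
  · intro h
    constructor <;> refine spec_injective hK fun f => ?_
    · rw [spec_tProd hK, spec_ctrans hK, spec_idTensor hK, h f]
    · rw [spec_tProd hK, spec_ctrans hK, spec_idTensor hK, mul_eq_one_comm.mp (h f)]

theorem eq_tProd_iff (hK : kron T * (kron T)⁻¹ = 1) {a b : ℕ} (U : Tensor ℂ a a n)
    (S X : Tensor ℂ a b n) (V : Tensor ℂ b b n) :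
    X = tProd T (tProd T U S) (ctrans T V) ↔
      ∀ f, spec T X f = spec T U f * spec T S f * (spec T V f)ᴴ := by
  constructor
  · rintro rfl f
    rw [spec_tProd hK, spec_tProd hK, spec_ctrans hK]
  · intro h
    refine spec_injective hK fun f => ?_
    rw [spec_tProd hK, spec_tProd hK, spec_ctrans hK, h f]

/-- The product of two `1 × 1` unit tubes is real; the entries of these products are the structure
constants, and each row of `kron T` is a character of the resulting algebra. -/
theorem ProductReal.structureConstants (hK : kron T * (kron T)⁻¹ = 1) (hreal : ProductReal T) :
    ∃ t : Idx n → Idx n → Idx n → ℝ, ∀ f j k,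
      kron T f j * kron T f k = ∑ l, kron T f l * (t j k l : ℂ) := by
  let E : Idx n → Tensor ℝ 1 1 n := fun j _ _ g => if g = j then 1 else 0
  choose C hC using fun j k => hreal 1 1 1 (E j) (E k)
  have hE : ∀ j f, spec T (toC (E j)) f 0 0 = kron T f j := by
    intro j f
    rw [spec_apply, Finset.sum_eq_single j] <;> simp +contextual [toC, E]
  refine ⟨fun j k => C j k 0 0, fun f j k => ?_⟩
  have := congrArg (fun A => spec T A f 0 0) (hC j k)
  simp only [spec_tProd hK, Matrix.mul_apply, Fin.sum_univ_one, hE] at this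
  exact this

/-- Real structure constants make the conjugate of a character again a character. Since the algebra
is a product of copies of `ℂ`, its only nonzero characters are the rows of `kron T`, so conjugation
permutes these rows. -/
theorem ProductReal.exists_involution (hK : kron T * (kron T)⁻¹ = 1) (hreal : ProductReal T) :
    ∃ s : Idx n → Idx n, Function.Involutive s ∧ ∀ f g, star (kron T f g) = kron T (s f) g := by
  classical
  obtain ⟨t, ht⟩ := hreal.structureConstants hK
  set K := kron T with hKdef
  have hK' : K⁻¹ * K = 1 := mul_eq_one_comm.mp hK
  have hmul : ∀ a : Idx n → ℂ, (∀ j k, a j * a k = ∑ l, a l * (t j k l : ℂ)) →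
      ∀ u v : Idx n → ℂ, (a ⬝ᵥ u) * (a ⬝ᵥ v) =
        a ⬝ᵥ fun l => ∑ j, ∑ k, (t j k l : ℂ) * (u j * v k) := by
    intro a ha u v
    calc (a ⬝ᵥ u) * (a ⬝ᵥ v) = ∑ j, ∑ k, (a j * a k) * (u j * v k) := by
          simp only [dotProduct, Finset.sum_mul_sum]
          exact Finset.sum_congr rfl fun j _ => Finset.sum_congr rfl fun k _ => by ring
      _ = ∑ j, ∑ k, ∑ l, a l * ((t j k l : ℂ) * (u j * v k)) := by
          refine Finset.sum_congr rfl fun j _ => Finset.sum_congr rfl fun k _ => ?_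
          rw [ha, Finset.sum_mul]
          exact Finset.sum_congr rfl fun l _ => by ring
      _ = ∑ j, ∑ l, ∑ k, a l * ((t j k l : ℂ) * (u j * v k)) :=
          Finset.sum_congr rfl fun j _ => Finset.sum_comm
      _ = ∑ l, ∑ j, ∑ k, a l * ((t j k l : ℂ) * (u j * v k)) := Finset.sum_comm
      _ = _ := by simp only [dotProduct, Finset.mul_sum]
  have hrow : ∀ f, ∃ g, ∀ j, star (K f j) = K g j := by
    intro f
    set χ : Idx n → ℂ := fun j => star (K f j) with hχ
    have hχt : ∀ j k, χ j * χ k = ∑ l, χ l * (t j k l : ℂ) := by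
      intro j k
      have := congrArg star (ht f j k)
      rw [star_mul', star_sum] at this
      simp only [star_mul'] at this
      rw [hχ]
      simp only
      rw [this]
      refine Finset.sum_congr rfl fun l _ => ?_
      congr 1
      exact Complex.conj_ofReal _
    -- The columns of `K⁻¹` are the primitive idempotents of the algebra, and `c g` is the value of
    -- `χ` on the one with index `g`. Orthogonality of the idempotents leaves exactly one nonzero
    -- value, equal to `1`.
    set c : Idx n → ℂ := χ ᵥ* K⁻¹ with hc
    have hcK : c ᵥ* K = χ := by rw [hc, Matrix.vecMul_vecMul, hK', Matrix.vecMul_one]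
    have hcol : ∀ m g, (K m ⬝ᵥ fun j => K⁻¹ j g) = if m = g then 1 else 0 := by
      intro m g
      rw [← Matrix.one_apply, ← hK]; rfl
    have hcc : ∀ g h, c g * c h = if g = h then c g else 0 := by
      intro g h
      have h1 : c g * c h = (χ ⬝ᵥ fun j => K⁻¹ j g) * (χ ⬝ᵥ fun j => K⁻¹ j h) := rfl
      rw [h1, hmul χ hχt, ← hcK, ← Matrix.dotProduct_mulVec]
      have h2 : (K *ᵥ fun l => ∑ j, ∑ k, (t j k l : ℂ) * (K⁻¹ j g * K⁻¹ k h)) =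
          fun m => if m = g then if m = h then 1 else 0 else 0 := by
        funext m
        have := hmul (K m) (ht m) (fun j => K⁻¹ j g) (fun j => K⁻¹ j h)
        rw [hcol, hcol] at this
        simp only [ite_mul, one_mul, zero_mul] at this
        exact this.symm
      rw [h2]
      simp [dotProduct]
    have hne : ∃ g, c g ≠ 0 := by
      by_contra! h0
      have hχ0 : χ = 0 := by
        rw [← hcK, show c = 0 from funext h0, Matrix.zero_vecMul]
      have hf : ∀ j, K f j = 0 := fun j => star_eq_zero.mp (congrFun hχ0 j)
      have := congrFun (congrFun hK f) f
      rw [Matrix.mul_apply, Matrix.one_apply_eq] at this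
      simp [hf] at this
    obtain ⟨g, hg⟩ := hne
    have hg1 : c g = 1 := by
      have := hcc g g
      rw [if_pos rfl] at this
      exact mul_left_cancel₀ hg (by rw [this, mul_one])
    have hother : ∀ h, h ≠ g → c h = 0 := by
      intro h hh
      have := hcc g h
      rw [if_neg hh.symm] at this
      exact (mul_eq_zero.mp this).resolve_left hg
    refine ⟨g, fun j => ?_⟩
    have := congrFun hcK j
    rw [Matrix.vecMul, dotProduct, Finset.sum_eq_single g
      (fun h _ hh => by rw [hother h hh, zero_mul])
      (fun h => absurd (Finset.mem_univ _) h), hg1, one_mul] at this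
    exact this.symm
  choose s hs using hrow
  refine ⟨s, fun f => ?_, hs⟩
  by_contra hne
  have hrow' : ∀ j, K (s (s f)) j = K f j := fun j => by rw [← hs, ← hs, star_star]
  have h1 := congrFun (congrFun hK (s (s f))) f
  have h2 := congrFun (congrFun hK f) f
  rw [Matrix.one_apply_ne hne, Matrix.mul_apply] at h1
  rw [Matrix.one_apply_eq, Matrix.mul_apply] at h2
  simp only [hrow'] at h1
  rw [h1] at h2
  exact zero_ne_one h2

/-- A family of matrices indexed by the frontal slices is equivariant if the involution `s` of the
index set acts as entrywise complex conjugation. -/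
def Equivariant (s : Idx n → Idx n) {a b : ℕ} (F : Idx n → Matrix (Fin a) (Fin b) ℂ) : Prop :=
  ∀ f, F (s f) = (F f).map star

theorem map_star_mul {α β γ : Type*} [Fintype β] (A : Matrix α β ℂ) (B : Matrix β γ ℂ) :
    (A * B).map star = A.map star * B.map star :=
  Matrix.map_mul (f := starRingEnd ℂ)

theorem map_star_conjTranspose {α β : Type*} (A : Matrix α β ℂ) :
    Aᴴ.map star = (A.map star)ᴴ := by
  ext; simp

theorem map_star_map_star {α β : Type*} (A : Matrix α β ℂ) : (A.map star).map star = A := by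
  ext; simp

theorem map_star_one {α : Type*} [DecidableEq α] :
    (1 : Matrix α α ℂ).map star = 1 := Matrix.map_one _ (star_zero _) (star_one _)

theorem Equivariant.mul {s : Idx n → Idx n} {a b c : ℕ} {F : Idx n → Matrix (Fin a) (Fin b) ℂ}
    {G : Idx n → Matrix (Fin b) (Fin c) ℂ} (hF : Equivariant s F) (hG : Equivariant s G) :
    Equivariant s fun f => F f * G f := fun f => by
  simp only [hF f, hG f, map_star_mul]

theorem Equivariant.conjTranspose {s : Idx n → Idx n} {a b : ℕ}
    {F : Idx n → Matrix (Fin a) (Fin b) ℂ} (hF : Equivariant s F) :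
    Equivariant s fun f => (F f)ᴴ := fun f => by
  simp only [hF f, map_star_conjTranspose]

theorem spec_star {s : Idx n → Idx n} (hKs : ∀ f g, star (kron T f g) = kron T (s f) g)
    {a b : ℕ} (A : Tensor ℂ a b n) (f : Idx n) :
    spec T (fun i j g => star (A i j g)) (s f) = (spec T A f).map star := by
  ext i j
  simp [spec_apply, ← hKs]

theorem equivariant_spec_toC {s : Idx n → Idx n}
    (hKs : ∀ f g, star (kron T f g) = kron T (s f) g) {a b : ℕ} (A : Tensor ℝ a b n) :
    Equivariant s (spec T (toC A)) := fun f => by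
  rw [← spec_star hKs]
  congr 1
  funext i j g
  exact (Complex.conj_ofReal _).symm

/-- Converse to `equivariant_spec_toC`: the inverse transform of `F` and its complex conjugate have
the same slices, so they coincide. Unitary families built slice by slice thus come from real
tensors. -/
theorem Equivariant.exists_spec_eq {s : Idx n → Idx n}
    (hKs : ∀ f g, star (kron T f g) = kron T (s f) g) (hK : kron T * (kron T)⁻¹ = 1)
    (hs : Function.Involutive s) {a b : ℕ} {F : Idx n → Matrix (Fin a) (Fin b) ℂ} (hF : Equivariant s F) :
    ∃ A : Tensor ℝ a b n, ∀ f, spec T (toC A) f = F f := by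
  set B := invTransform T (ofFaces F) with hB
  have hBF : ∀ f, spec T B f = F f := spec_invTransform hK F
  have hreal : (fun i j g => star (B i j g)) = B := by
    refine spec_injective hK fun f => ?_
    rw [← hs f, spec_star hKs, hBF, ← hF, hBF]
  refine ⟨fun i j g => (B i j g).re, fun f => ?_⟩
  rw [← hBF]
  congr 1
  funext i j g
  exact Complex.conj_eq_iff_re.mp (congrFun (congrFun (congrFun hreal i) j) g)

/-- Parseval on each tube, from `Kᴴ K = ρ I` for `K = kron T`. -/
theorem ScaledUnitary.sum_norm_spec (hT : ScaledUnitary T ρ) {a b : ℕ} (A : Tensor ℝ a b n) :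
    ∑ f, ∑ i, ∑ j, ‖spec T (toC A) f i j‖ ^ 2 = ρ * frobSq A := by
  have key : ∀ v : Idx n → ℂ, ∑ f, ‖(kron T *ᵥ v) f‖ ^ 2 = ρ * ∑ f, ‖v f‖ ^ 2 := by
    intro v
    have hn : ∀ w : Idx n → ℂ, ((∑ f, ‖w f‖ ^ 2 : ℝ) : ℂ) = star w ⬝ᵥ w := by
      intro w
      push_cast
      exact Finset.sum_congr rfl fun f _ => (RCLike.conj_mul (w f)).symm
    have h : ((∑ f, ‖(kron T *ᵥ v) f‖ ^ 2 : ℝ) : ℂ) = ((ρ * ∑ f, ‖v f‖ ^ 2 : ℝ) : ℂ) := by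
      rw [hn, Complex.ofReal_mul, hn, Matrix.star_mulVec, ← Matrix.dotProduct_mulVec,
        Matrix.mulVec_mulVec, hT.2, Matrix.smul_mulVec, Matrix.one_mulVec, dotProduct_smul,
        smul_eq_mul]
    exact_mod_cast h
  rw [Finset.sum_comm, frobSq, Finset.mul_sum]
  refine Finset.sum_congr rfl fun i _ => ?_
  rw [Finset.sum_comm, Finset.mul_sum]
  refine Finset.sum_congr rfl fun j _ => ?_
  have h₁ := key (toC A i j)
  have h₂ : ∑ f, ‖toC A i j f‖ ^ 2 = ∑ f, A i j f ^ 2 := by simp [toC]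
  rw [h₂] at h₁
  exact h₁

theorem spec_sub {a b : ℕ} (A B : Tensor ℝ a b n) (f : Idx n) :
    spec T (toC (A - B)) f = spec T (toC A) f - spec T (toC B) f := by
  ext i j
  simp [spec_apply, toC, mul_sub]

/-- The transform acts invertibly on each tube, so a tube vanishes exactly when its transform does.
-/
theorem isFDiagonal_iff (hK : kron T * (kron T)⁻¹ = 1) {a b : ℕ} (A : Tensor ℝ a b n) :
    IsFDiagonal A ↔
      ∀ f (i : Fin a) (j : Fin b), (i : ℕ) ≠ j → spec T (toC A) f i j = 0 := by
  constructor
  · intro h f i j hij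
    rw [spec_apply]
    exact Finset.sum_eq_zero fun g _ => by simp [toC, h i j g hij]
  · intro h i j f hij
    have h0 : kron T *ᵥ toC A i j = 0 := funext fun f => h f i j hij
    have h1 := congrArg (fun v => (kron T)⁻¹ *ᵥ v) h0
    simp only [Matrix.mulVec_mulVec, mul_eq_one_comm.mp hK, Matrix.one_mulVec,
      Matrix.mulVec_zero] at h1
    exact Complex.ofReal_eq_zero.mp (congrFun h1 f)

/-- Equivariant choice of solutions of an equivariant family of problems. -/
theorem exists_equivariant_choice {ι α : Type*} [Finite ι] {s : ι → ι}
    (hs : Function.Involutive s) {c : α → α} (hc : Function.Involutive c) (P : ι → α → Prop)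
    (h₁ : ∀ f, ∃ u, P f u ∧ (s f = f → c u = u)) (h₂ : ∀ f u, P f u → P (s f) (c u)) :
    ∃ u : ι → α, ∀ f, P f (u f) ∧ u (s f) = c (u f) := by
  classical
  obtain ⟨N, ⟨e⟩⟩ := Finite.exists_equiv_fin ι
  choose v hv hv' using h₁
  -- An enumeration selects one representative of each orbit `{f, s f}`; its solution is carried to
  -- the other point by `c`. At a fixed point this is consistent because the solution there is fixed
  -- by `c`.
  refine ⟨fun f => if e f ≤ e (s f) then v f else c (v (s f)), fun f => ⟨?_, ?_⟩⟩
  · dsimp only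
    split_ifs with h
    · exact hv f
    · have := h₂ _ _ (hv (s f))
      rwa [hs f] at this
  · dsimp only
    rw [hs f]
    rcases lt_trichotomy (e f) (e (s f)) with h | h | h
    · rw [if_neg (not_le.mpr h), if_pos h.le]
    · have hf : s f = f := (e.injective h).symm
      rw [hf, if_pos le_rfl, hv' f hf]
    · rw [if_pos h.le, if_neg (not_le.mpr h), hc]

end Spectrum

/-! ### Real solutions of the matrix problems, needed on slices fixed by `s`. -/

section RealForms

theorem map_ofReal_map_star {α β : Type*} (A : Matrix α β ℝ) :
    (A.map Complex.ofReal).map star = A.map Complex.ofReal := by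
  ext i j
  exact Complex.conj_ofReal _

theorem eq_map_ofReal {α β : Type*} {A : Matrix α β ℂ} (hA : A.map star = A) :
    A = (A.map Complex.re).map Complex.ofReal := by
  ext i j
  exact (Complex.conj_eq_iff_re.mp (congrFun (congrFun hA i) j)).symm

theorem map_ofReal_mul {α β γ : Type*} [Fintype β] (A : Matrix α β ℝ) (B : Matrix β γ ℝ) :
    (A * B).map Complex.ofReal = A.map Complex.ofReal * B.map Complex.ofReal :=
  Matrix.map_mul (f := Complex.ofRealHom)

theorem map_ofReal_conjTranspose {α β : Type*} (A : Matrix α β ℝ) :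
    Aᴴ.map Complex.ofReal = (A.map Complex.ofReal)ᴴ := by
  ext i j
  exact (Complex.conj_ofReal _).symm

theorem map_ofReal_one {α : Type*} [DecidableEq α] :
    (1 : Matrix α α ℝ).map Complex.ofReal = 1 :=
  Matrix.map_one _ Complex.ofReal_zero Complex.ofReal_one

theorem map_ofReal_injective {α β : Type*} {A B : Matrix α β ℝ}
    (h : A.map Complex.ofReal = B.map Complex.ofReal) : A = B := by
  ext i j
  exact Complex.ofReal_injective (congrFun (congrFun h i) j)

theorem trace_map_ofReal_re {α : Type*} [Fintype α] (A : Matrix α α ℝ) :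
    (A.map Complex.ofReal).trace.re = A.trace := by
  simp [Matrix.trace]

/-- `exists_unitary_trace_ge` with a real solution for a real matrix. -/
theorem exists_unitary_trace_ge_complex {α : Type*} [Fintype α] [DecidableEq α]
    (Y : Matrix α α ℂ) :
    ∃ Q : Matrix α α ℂ, (Qᴴ * Q = 1 ∧ Y.trace.re ≤ (Q * Y).trace.re ∧
      ((Q * Y).trace.re ≤ Y.trace.re → Y.IsHermitian)) ∧ (Y.map star = Y → Q.map star = Q) := by
  by_cases hY : Y.map star = Y
  · set Y' := Y.map Complex.re
    have hY' : Y = Y'.map Complex.ofReal := eq_map_ofReal hY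
    obtain ⟨Q, hQ, h₁, h₂⟩ := exists_unitary_trace_ge Y'
    refine ⟨Q.map Complex.ofReal, ⟨?_, ?_, ?_⟩, fun _ => map_ofReal_map_star Q⟩
    · rw [← map_ofReal_conjTranspose, ← map_ofReal_mul, hQ, map_ofReal_one]
    · rw [hY', ← map_ofReal_mul, trace_map_ofReal_re, trace_map_ofReal_re]
      exact h₁
    · rw [hY', ← map_ofReal_mul, trace_map_ofReal_re, trace_map_ofReal_re]
      intro h
      rw [Matrix.IsHermitian, ← map_ofReal_conjTranspose, h₂ h]
  · obtain ⟨Q, hQ⟩ := exists_unitary_trace_ge Y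
    exact ⟨Q, hQ, fun h => absurd h hY⟩

/-- `exists_stabilizer_diagonalize_fin` with a real solution for real matrices. -/
theorem exists_stabilizer_diagonalize_complex {a b : ℕ} (D Z : Matrix (Fin a) (Fin b) ℂ)
    (hD : ∀ (i : Fin a) (j : Fin b), (i : ℕ) ≠ j → D i j = 0)
    (h₁ : (D * Zᴴ).IsHermitian) (h₂ : (Dᴴ * Z).IsHermitian) :
    ∃ (Q : Matrix (Fin a) (Fin a) ℂ) (R : Matrix (Fin b) (Fin b) ℂ),
      (Qᴴ * Q = 1 ∧ Rᴴ * R = 1 ∧ Qᴴ * D * R = D ∧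
        ∀ (i : Fin a) (j : Fin b), (i : ℕ) ≠ j → (Qᴴ * Z * R) i j = 0) ∧
      (D.map star = D → Z.map star = Z → Q.map star = Q ∧ R.map star = R) := by
  by_cases hDZ : D.map star = D ∧ Z.map star = Z
  · set D' := D.map Complex.re with hD'def
    set Z' := Z.map Complex.re
    have hD' : D = D'.map Complex.ofReal := eq_map_ofReal hDZ.1
    have hZ' : Z = Z'.map Complex.ofReal := eq_map_ofReal hDZ.2
    obtain ⟨Q, R, hQ, hR, h₃, h₄⟩ := exists_stabilizer_diagonalize_fin D' Z'
      (fun i j hij => by simp [hD'def, hD i j hij])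
      (map_ofReal_injective (by
        rw [map_ofReal_conjTranspose, map_ofReal_mul, map_ofReal_conjTranspose, ← hD', ← hZ',
          h₁.eq]))
      (map_ofReal_injective (by
        rw [map_ofReal_conjTranspose, map_ofReal_mul, map_ofReal_conjTranspose, ← hD', ← hZ',
          h₂.eq]))
    refine ⟨Q.map Complex.ofReal, R.map Complex.ofReal, ⟨?_, ?_, ?_, ?_⟩,
      fun _ _ => ⟨map_ofReal_map_star Q, map_ofReal_map_star R⟩⟩
    · rw [← map_ofReal_conjTranspose, ← map_ofReal_mul, hQ, map_ofReal_one]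
    · rw [← map_ofReal_conjTranspose, ← map_ofReal_mul, hR, map_ofReal_one]
    · rw [hD', ← map_ofReal_conjTranspose, ← map_ofReal_mul, ← map_ofReal_mul, h₃]
    · intro i j hij
      rw [hZ', ← map_ofReal_conjTranspose, ← map_ofReal_mul, ← map_ofReal_mul, Matrix.map_apply,
        h₄ i j hij, Complex.ofReal_zero]
  · obtain ⟨Q, R, h⟩ := exists_stabilizer_diagonalize_fin D Z hD h₁ h₂
    exact ⟨Q, R, h, fun h₃ h₄ => absurd ⟨h₃, h₄⟩ hDZ⟩

end RealForms

/-! ### The matrix lemmas for equivariant families of slices. -/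

section Families

variable {r : ℕ} {n : Fin r → ℕ} {s : Idx n → Idx n}

theorem trace_map_star_re {α : Type*} [Fintype α] (A : Matrix α α ℂ) :
    (A.map star).trace.re = A.trace.re := by
  simp [Matrix.trace]

theorem conjTranspose_mul_self_map_star {α : Type*} [Fintype α] [DecidableEq α]
    {Q : Matrix α α ℂ} (hQ : Qᴴ * Q = 1) : (Q.map star)ᴴ * Q.map star = 1 := by
  rw [← map_star_conjTranspose, ← map_star_mul, hQ, map_star_one]

/-- The hypothesis bounds only the sum over slices. An equivariant choice of the trace-increasing
unitaries weakly increases every summand, so equality of the sums forces equality on each slice. -/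
theorem Equivariant.isHermitian_of_trace_le (hs : Function.Involutive s) {a : ℕ}
    {Y : Idx n → Matrix (Fin a) (Fin a) ℂ} (hY : Equivariant s Y)
    (h : ∀ Q : Idx n → Matrix (Fin a) (Fin a) ℂ, Equivariant s Q → (∀ f, (Q f)ᴴ * Q f = 1) →
      ∑ f, (Q f * Y f).trace.re ≤ ∑ f, (Y f).trace.re) (f : Idx n) : (Y f).IsHermitian := by
  obtain ⟨Q, hQ⟩ := exists_equivariant_choice hs
    (c := fun A : Matrix (Fin a) (Fin a) ℂ => A.map star) map_star_map_star
    (fun f Q => Qᴴ * Q = 1 ∧ (Y f).trace.re ≤ (Q * Y f).trace.re ∧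
      ((Q * Y f).trace.re ≤ (Y f).trace.re → (Y f).IsHermitian))
    (fun f => by
      obtain ⟨Q, h₁, h₂⟩ := exists_unitary_trace_ge_complex (Y f)
      exact ⟨Q, h₁, fun hf => h₂ (by rw [← hY f, hf])⟩)
    (fun f Q hQ => by
      refine ⟨conjTranspose_mul_self_map_star hQ.1, ?_, ?_⟩
      · rw [hY f, ← map_star_mul, trace_map_star_re, trace_map_star_re]
        exact hQ.2.1
      · rw [hY f, ← map_star_mul, trace_map_star_re, trace_map_star_re]
        intro hle
        rw [Matrix.IsHermitian, ← map_star_conjTranspose, hQ.2.2 hle])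
  have hle := h Q (fun f => (hQ f).2) fun f => (hQ f).1.1
  have heq : ∑ f, (Y f).trace.re = ∑ f, (Q f * Y f).trace.re :=
    le_antisymm (Finset.sum_le_sum fun f _ => (hQ f).1.2.1) hle
  have := (Finset.sum_eq_sum_iff_of_le fun f _ => (hQ f).1.2.1).mp heq f (Finset.mem_univ f)
  exact (hQ f).1.2.2 this.ge

theorem Equivariant.exists_stabilizer_diagonalize (hs : Function.Involutive s) {a b : ℕ}
    {D Z : Idx n → Matrix (Fin a) (Fin b) ℂ} (hD : Equivariant s D) (hZ : Equivariant s Z)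
    (hdiag : ∀ f (i : Fin a) (j : Fin b), (i : ℕ) ≠ j → D f i j = 0)
    (h₁ : ∀ f, (D f * (Z f)ᴴ).IsHermitian) (h₂ : ∀ f, ((D f)ᴴ * Z f).IsHermitian) :
    ∃ (Q : Idx n → Matrix (Fin a) (Fin a) ℂ) (R : Idx n → Matrix (Fin b) (Fin b) ℂ),
      Equivariant s Q ∧ Equivariant s R ∧ (∀ f, (Q f)ᴴ * Q f = 1) ∧ (∀ f, (R f)ᴴ * R f = 1) ∧
      (∀ f, (Q f)ᴴ * D f * R f = D f) ∧
      ∀ f (i : Fin a) (j : Fin b), (i : ℕ) ≠ j → ((Q f)ᴴ * Z f * R f) i j = 0 := by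
  obtain ⟨u, hu⟩ := exists_equivariant_choice hs
    (c := fun A : Matrix (Fin a) (Fin a) ℂ × Matrix (Fin b) (Fin b) ℂ =>
      (A.1.map star, A.2.map star))
    (fun A => by simp only [map_star_map_star])
    (fun f A => (A.1)ᴴ * A.1 = 1 ∧ (A.2)ᴴ * A.2 = 1 ∧ (A.1)ᴴ * D f * A.2 = D f ∧
      ∀ (i : Fin a) (j : Fin b), (i : ℕ) ≠ j → ((A.1)ᴴ * Z f * A.2) i j = 0)
    (fun f => by
      obtain ⟨Q, R, h₃, h₄⟩ := exists_stabilizer_diagonalize_complex (D f) (Z f) (hdiag f)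
        (h₁ f) (h₂ f)
      refine ⟨(Q, R), h₃, fun hf => ?_⟩
      obtain ⟨h₅, h₆⟩ := h₄ (by rw [← hD f, hf]) (by rw [← hZ f, hf])
      exact Prod.ext h₅ h₆)
    (fun f A hA => by
      refine ⟨conjTranspose_mul_self_map_star hA.1, conjTranspose_mul_self_map_star hA.2.1,
        ?_, ?_⟩
      · rw [hD f, ← map_star_conjTranspose, ← map_star_mul, ← map_star_mul, hA.2.2.1]
      · intro i j hij
        rw [hZ f, ← map_star_conjTranspose, ← map_star_mul, ← map_star_mul, Matrix.map_apply,
          hA.2.2.2 i j hij, star_zero])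
  exact ⟨fun f => (u f).1, fun f => (u f).2, fun f => congrArg Prod.fst (hu f).2,
    fun f => congrArg Prod.snd (hu f).2, fun f => (hu f).1.1, fun f => (hu f).1.2.1,
    fun f => (hu f).1.2.2.1, fun f => (hu f).1.2.2.2⟩

end Families

/-! ### The Frobenius norm of a slice. -/

section NormSq

variable {a b : ℕ}

/-- The squared Frobenius norm of a complex matrix. -/
noncomputable def normSq (A : Matrix (Fin a) (Fin b) ℂ) : ℝ := ∑ i, ∑ j, ‖A i j‖ ^ 2

theorem normSq_eq_trace (A : Matrix (Fin a) (Fin b) ℂ) : normSq A = (A * Aᴴ).trace.re := by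
  simp only [normSq, Matrix.trace, Matrix.diag_apply, Matrix.mul_apply,
    Matrix.conjTranspose_apply, Complex.re_sum]
  refine Finset.sum_congr rfl fun i _ => Finset.sum_congr rfl fun j _ => ?_
  have : A i j * star (A i j) = (‖A i j‖ : ℂ) ^ 2 := RCLike.mul_conj _
  rw [this, ← Complex.ofReal_pow, Complex.ofReal_re]

theorem normSq_sub (A B : Matrix (Fin a) (Fin b) ℂ) :
    normSq (A - B) = normSq A + normSq B - 2 * (A * Bᴴ).trace.re := by
  have h : (B * Aᴴ).trace.re = (A * Bᴴ).trace.re := by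
    rw [← Complex.conj_re, ← Matrix.conjTranspose_conjTranspose B, ← Matrix.conjTranspose_mul,
      Matrix.trace_conjTranspose]
    simp
  simp only [normSq_eq_trace, Matrix.conjTranspose_sub, Matrix.sub_mul, Matrix.mul_sub,
    Matrix.trace_sub, Complex.sub_re]
  rw [h]; ring

theorem normSq_unitary_mul_mul {U : Matrix (Fin a) (Fin a) ℂ} {V : Matrix (Fin b) (Fin b) ℂ}
    (hU : Uᴴ * U = 1) (hV : Vᴴ * V = 1) (A : Matrix (Fin a) (Fin b) ℂ) :
    normSq (U * A * Vᴴ) = normSq A := by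
  rw [normSq_eq_trace, normSq_eq_trace]
  congr 1
  have h : U * A * Vᴴ * (U * A * Vᴴ)ᴴ = U * (A * (Vᴴ * V) * Aᴴ * Uᴴ) := by
    simp only [Matrix.conjTranspose_mul, Matrix.conjTranspose_conjTranspose, Matrix.mul_assoc]
  rw [h, hV, Matrix.trace_mul_comm, Matrix.mul_assoc, hU, Matrix.mul_one, Matrix.mul_one]

end NormSq

/-! ### Existence of t-SVDs, attainment of the infimum, and stationarity of a minimizer. -/

section TSVD

variable {r : ℕ} {n : Fin r → ℕ} {T : TransformMatrices n} {ρ : ℝ} {s : Idx n → Idx n} {a b : ℕ}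

theorem isTSVD_iff (hK : kron T * (kron T)⁻¹ = 1) (U : Tensor ℝ a a n) (S : Tensor ℝ a b n)
    (V : Tensor ℝ b b n) (X : Tensor ℝ a b n) :
    IsTSVD T U S V X ↔ (∀ f, (spec T (toC U) f)ᴴ * spec T (toC U) f = 1) ∧
      (∀ f, (spec T (toC V) f)ᴴ * spec T (toC V) f = 1) ∧ IsFDiagonal S ∧
      ∀ f, spec T (toC X) f =
        spec T (toC U) f * spec T (toC S) f * (spec T (toC V) f)ᴴ := by
  rw [IsTSVD, isOrthogonal_iff hK, isOrthogonal_iff hK, eq_tProd_iff hK]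

theorem ScaledUnitary.sum_normSq_spec (hT : ScaledUnitary T ρ) (A : Tensor ℝ a b n) :
    ∑ f, normSq (spec T (toC A) f) = ρ * frobSq A :=
  hT.sum_norm_spec A

theorem exists_isTSVD (hK : kron T * (kron T)⁻¹ = 1) (hs : Function.Involutive s)
    (hKs : ∀ f g, star (kron T f g) = kron T (s f) g) (X : Tensor ℝ a b n) :
    ∃ U S V, IsTSVD T U S V X := by
  have hX := equivariant_spec_toC hKs X
  -- With `D = 0` the stabilizer condition is empty and only the diagonalization of the slices of
  -- `X` remains.
  obtain ⟨Q, R, hQ, hR, hQ1, hR1, -, hdiag⟩ := Equivariant.exists_stabilizer_diagonalize hs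
    (D := fun _ => (0 : Matrix (Fin a) (Fin b) ℂ)) (fun f => by ext; simp) hX
    (by simp) (by simp) (by simp)
  obtain ⟨U, hU⟩ := hQ.exists_spec_eq hKs hK hs
  obtain ⟨V, hV⟩ := hR.exists_spec_eq hKs hK hs
  obtain ⟨S, hS⟩ := ((hQ.conjTranspose.mul hX).mul hR).exists_spec_eq hKs hK hs
  refine ⟨U, S, V, (isTSVD_iff hK _ _ _ _).2 ⟨?_, ?_, ?_, ?_⟩⟩
  · simpa only [hU] using hQ1
  · simpa only [hV] using hR1
  · rw [isFDiagonal_iff hK]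
    simpa only [hS] using hdiag
  · intro f
    rw [hU, hV, hS]
    calc spec T (toC X) f = (Q f * (Q f)ᴴ) * spec T (toC X) f * (R f * (R f)ᴴ) := by
          rw [mul_eq_one_comm.mp (hQ1 f), mul_eq_one_comm.mp (hR1 f), Matrix.one_mul,
            Matrix.mul_one]
      _ = _ := by simp only [Matrix.mul_assoc]

theorem l1Norm_nonneg (A : Tensor ℝ a b n) : 0 ≤ l1Norm A := by
  unfold l1Norm; positivity

theorem norm_le_sqrt_frobSq (A : Tensor ℝ a b n) : ‖A‖ ≤ √(frobSq A) := by
  refine (pi_norm_le_iff_of_nonneg (Real.sqrt_nonneg _)).2 fun i =>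
    (pi_norm_le_iff_of_nonneg (Real.sqrt_nonneg _)).2 fun j =>
    (pi_norm_le_iff_of_nonneg (Real.sqrt_nonneg _)).2 fun f => ?_
  refine Real.le_sqrt_of_sq_le ?_
  rw [Real.norm_eq_abs, sq_abs]
  calc A i j f ^ 2 ≤ ∑ f, A i j f ^ 2 :=
        Finset.single_le_sum (f := fun f => A i j f ^ 2) (fun _ _ => sq_nonneg _)
          (Finset.mem_univ f)
    _ ≤ ∑ j, ∑ f, A i j f ^ 2 :=
        Finset.single_le_sum (f := fun j => ∑ f, A i j f ^ 2) (fun _ _ => by positivity)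
          (Finset.mem_univ j)
    _ ≤ frobSq A :=
        Finset.single_le_sum (f := fun i => ∑ j, ∑ f, A i j f ^ 2) (fun _ _ => by positivity)
          (Finset.mem_univ i)

theorem continuous_spec (f : Idx n) :
    Continuous fun A : Tensor ℝ a b n => spec T (toC A) f := by
  refine continuous_matrix fun i j => ?_
  simp only [spec_apply, toC]
  fun_prop

theorem continuous_l1Norm : Continuous (l1Norm : Tensor ℝ a b n → ℝ) := by
  unfold l1Norm
  fun_prop

theorem ScaledUnitary.norm_orthogonal_le (hT : ScaledUnitary T ρ) (hρ : 0 < ρ)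
    {U : Tensor ℝ a a n} (hU : ∀ f, (spec T (toC U) f)ᴴ * spec T (toC U) f = 1) :
    ‖U‖ ≤ √(ρ⁻¹ * ∑ _f : Idx n, normSq (1 : Matrix (Fin a) (Fin a) ℂ)) := by
  refine (norm_le_sqrt_frobSq U).trans (Real.sqrt_le_sqrt ?_)
  rw [le_inv_mul_iff₀ hρ, ← hT.sum_normSq_spec]
  refine Finset.sum_le_sum fun f _ => ?_
  have h := normSq_unitary_mul_mul (hU f) (V := (1 : Matrix (Fin a) (Fin a) ℂ)) (by simp) 1
  simp only [Matrix.mul_one, Matrix.conjTranspose_one] at h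
  exact h.le

/-- The defining equations are closed conditions on the slices. Orthogonal factors are bounded as
their slices are unitary, and the core has the Frobenius norm of `X`. -/
theorem isCompact_setOf_isTSVD (hρ : 0 < ρ) (hT : ScaledUnitary T ρ) (X : Tensor ℝ a b n) :
    IsCompact {P : Tensor ℝ a a n × Tensor ℝ a b n × Tensor ℝ b b n |
      IsTSVD T P.1 P.2.1 P.2.2 X} := by
  have hK := hT.kron_mul_inv hρ
  refine Metric.isCompact_of_isClosed_isBounded ?_ ?_
  · simp only [isTSVD_iff hK, IsFDiagonal, Set.ofPred_and, Set.ofPred_forall]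
    have c₁ : ∀ f, Continuous fun P : Tensor ℝ a a n × Tensor ℝ a b n × Tensor ℝ b b n =>
        spec T (toC P.1) f := fun f => (continuous_spec f).comp continuous_fst
    have c₂ : ∀ f, Continuous fun P : Tensor ℝ a a n × Tensor ℝ a b n × Tensor ℝ b b n =>
        spec T (toC P.2.1) f := fun f =>
      (continuous_spec f).comp (continuous_fst.comp continuous_snd)
    have c₃ : ∀ f, Continuous fun P : Tensor ℝ a a n × Tensor ℝ a b n × Tensor ℝ b b n =>
        spec T (toC P.2.2) f := fun f =>
      (continuous_spec f).comp (continuous_snd.comp continuous_snd)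
    refine IsClosed.inter ?_ (IsClosed.inter ?_ (IsClosed.inter ?_ ?_))
    · exact isClosed_iInter fun f => isClosed_eq
        ((c₁ f).matrix_conjTranspose.matrix_mul (c₁ f)) continuous_const
    · exact isClosed_iInter fun f => isClosed_eq
        ((c₃ f).matrix_conjTranspose.matrix_mul (c₃ f)) continuous_const
    · refine isClosed_iInter fun i => isClosed_iInter fun j => isClosed_iInter fun f =>
        isClosed_iInter fun _ => isClosed_eq ?_ continuous_const
      fun_prop
    · exact isClosed_iInter fun f => isClosed_eq continuous_const
        (((c₁ f).matrix_mul (c₂ f)).matrix_mul (c₃ f).matrix_conjTranspose)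
  · refine isBounded_iff_forall_norm_le.2
      ⟨max √(ρ⁻¹ * ∑ _f : Idx n, normSq (1 : Matrix (Fin a) (Fin a) ℂ))
        (max √(frobSq X) √(ρ⁻¹ * ∑ _f : Idx n, normSq (1 : Matrix (Fin b) (Fin b) ℂ))), ?_⟩
    rintro ⟨U, S, V⟩ h
    obtain ⟨hU, hV, -, hX⟩ := (isTSVD_iff hK _ _ _ _).1 h
    refine max_le_max (hT.norm_orthogonal_le hρ hU) (max_le_max ?_ (hT.norm_orthogonal_le hρ hV))
    have hS : frobSq S = frobSq X := by
      refine mul_left_cancel₀ hρ.ne' ?_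
      rw [← hT.sum_normSq_spec, ← hT.sum_normSq_spec]
      refine Finset.sum_congr rfl fun f _ => ?_
      rw [hX f, normSq_unitary_mul_mul (hU f) (hV f)]
    rw [← hS]
    exact norm_le_sqrt_frobSq S

theorem IsTSVD.nuclearL1_le {U : Tensor ℝ a a n} {S : Tensor ℝ a b n} {V : Tensor ℝ b b n}
    {X : Tensor ℝ a b n} (h : IsTSVD T U S V X) (p : ℝ) : nuclearL1 T p X ≤ l1Norm S ^ p :=
  csInf_le ⟨0, by rintro _ ⟨_, S, _, -, rfl⟩; exact Real.rpow_nonneg (l1Norm_nonneg S) p⟩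
    ⟨U, S, V, h, rfl⟩

/-- The infimum defining the nuclear norm is attained. -/
theorem exists_isTSVD_nuclearL1_eq (hρ : 0 < ρ) (hT : ScaledUnitary T ρ)
    (hs : Function.Involutive s) (hKs : ∀ f g, star (kron T f g) = kron T (s f) g) {p : ℝ}
    (hp : 0 ≤ p) (X : Tensor ℝ a b n) :
    ∃ U S V, IsTSVD T U S V X ∧ nuclearL1 T p X = l1Norm S ^ p := by
  obtain ⟨U₀, S₀, V₀, h₀⟩ := exists_isTSVD (hT.kron_mul_inv hρ) hs hKs X
  have hcont : Continuous fun P : Tensor ℝ a a n × Tensor ℝ a b n × Tensor ℝ b b n =>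
      l1Norm P.2.1 ^ p :=
    (continuous_l1Norm.comp (continuous_fst.comp continuous_snd)).rpow_const fun _ => Or.inr hp
  obtain ⟨P, h, hmin⟩ := (isCompact_setOf_isTSVD hρ hT X).exists_isMinOn
    ⟨(U₀, S₀, V₀), Set.mem_ofPred_eq.mpr h₀⟩ hcont.continuousOn
  rw [Set.mem_ofPred_eq] at h
  rw [isMinOn_iff] at hmin
  refine ⟨P.1, P.2.1, P.2.2, h, le_antisymm (h.nuclearL1_le p) ?_⟩
  refine le_csInf ⟨l1Norm P.2.1 ^ p, P.1, P.2.1, P.2.2, h, rfl⟩ ?_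
  rintro t ⟨U', S', V', h', rfl⟩
  exact hmin (U', S', V') (Set.mem_ofPred_eq.mpr h')

theorem ScaledUnitary.frobSq_sub (hT : ScaledUnitary T ρ) {X Z : Tensor ℝ a b n}
    {U : Idx n → Matrix (Fin a) (Fin a) ℂ} {V : Idx n → Matrix (Fin b) (Fin b) ℂ}
    {A B : Idx n → Matrix (Fin a) (Fin b) ℂ} (hU : ∀ f, (U f)ᴴ * U f = 1)
    (hV : ∀ f, (V f)ᴴ * V f = 1) (hX : ∀ f, spec T (toC X) f = U f * A f * (V f)ᴴ)
    (hZ : ∀ f, spec T (toC Z) f = U f * B f * (V f)ᴴ) :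
    ρ * frobSq (X - Z) = ∑ f, normSq (A f - B f) := by
  rw [← hT.sum_normSq_spec]
  refine Finset.sum_congr rfl fun f _ => ?_
  rw [spec_sub, hX, hZ, ← Matrix.sub_mul, ← Matrix.mul_sub, normSq_unitary_mul_mul (hU f) (hV f)]

/-- It suffices to compare with f-diagonal tensors in `proxL1`. -/
theorem mem_proxL1_of_fDiagonal {lam p : ℝ} (hlam : 0 ≤ lam) (hp : 0 ≤ p)
    {S D : Tensor ℝ a b n} (hS : IsFDiagonal S)
    (h : ∀ D' : Tensor ℝ a b n, IsFDiagonal D' →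
      1 / 2 * frobSq (D - S) + lam * l1Norm D ^ p ≤
        1 / 2 * frobSq (D' - S) + lam * l1Norm D' ^ p) : D ∈ proxL1 lam p S := by
  intro D'
  -- Deleting the off-diagonal entries lowers both terms, since `S` vanishes off the diagonal.
  let E : Tensor ℝ a b n := fun i j f => if (i : ℕ) = j then D' i j f else 0
  have hE : IsFDiagonal E := fun i j f hij => if_neg hij
  have h₁ : l1Norm E ≤ l1Norm D' := by
    refine Finset.sum_le_sum fun i _ => Finset.sum_le_sum fun j _ =>
      Finset.sum_le_sum fun f _ => ?_
    by_cases hij : (i : ℕ) = j <;> simp [E, hij]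
  have h₂ : frobSq (E - S) ≤ frobSq (D' - S) := by
    refine Finset.sum_le_sum fun i _ => Finset.sum_le_sum fun j _ =>
      Finset.sum_le_sum fun f _ => ?_
    by_cases hij : (i : ℕ) = j
    · simp [E, hij]
    · simp [E, hij, hS i j f hij, sq_nonneg]
  have h₃ := Real.rpow_le_rpow (l1Norm_nonneg E) h₁ hp
  have h₄ := mul_le_mul_of_nonneg_left h₃ hlam
  linarith [h E hE]

/-- A minimizer `X` with an optimal t-SVD has a core that is stationary with respect to `Z` under
the orthogonal group: on each frontal slice of the transform domain, `D Zᴴ` and `Dᴴ Z` are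
Hermitian, where `Z` is expressed in the coordinates of the t-SVD. -/
theorem isHermitian_of_mem_proxNuclear (hρ : 0 < ρ) (hT : ScaledUnitary T ρ)
    (hs : Function.Involutive s) (hKs : ∀ f g, star (kron T f g) = kron T (s f) g) {lam p : ℝ}
    (hlam : 0 < lam) {Z X : Tensor ℝ a b n} (hX : X ∈ proxNuclear T lam p Z)
    {U : Tensor ℝ a a n} {D : Tensor ℝ a b n} {V : Tensor ℝ b b n} (h : IsTSVD T U D V X)
    (hD : nuclearL1 T p X = l1Norm D ^ p) {Y : Idx n → Matrix (Fin a) (Fin b) ℂ}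
    (hY : Equivariant s Y)
    (hZ : ∀ f, spec T (toC Z) f = spec T (toC U) f * Y f * (spec T (toC V) f)ᴴ) :
    (∀ f, (spec T (toC D) f * (Y f)ᴴ).IsHermitian) ∧
      ∀ f, ((spec T (toC D) f)ᴴ * Y f).IsHermitian := by
  have hK := hT.kron_mul_inv hρ
  obtain ⟨hU, hV, hdiag, hXf⟩ := (isTSVD_iff hK _ _ _ _).1 h
  set Uf := spec T (toC U) with hUf
  set Vf := spec T (toC V) with hVf
  set Df := spec T (toC D) with hDf
  have eD : Equivariant s Df := equivariant_spec_toC hKs D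
  -- The competitor `X'` has the factors `U Q`, `V R` and the same core `D`, so its penalty is at
  -- most that of `X` and the distance to `Z` cannot shrink. The squared norms of the rotated core
  -- and of `Y` cancel, leaving the cross terms.
  have key : ∀ (Q : Idx n → Matrix (Fin a) (Fin a) ℂ) (R : Idx n → Matrix (Fin b) (Fin b) ℂ),
      Equivariant s Q → Equivariant s R → (∀ f, (Q f)ᴴ * Q f = 1) → (∀ f, (R f)ᴴ * R f = 1) →
      ∑ f, (Q f * Df f * (R f)ᴴ * (Y f)ᴴ).trace.re ≤ ∑ f, (Df f * (Y f)ᴴ).trace.re := by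
    intro Q R eQ eR hQ hR
    obtain ⟨U', hU'⟩ := ((equivariant_spec_toC hKs U).mul eQ).exists_spec_eq hKs hK hs
    obtain ⟨V', hV'⟩ := ((equivariant_spec_toC hKs V).mul eR).exists_spec_eq hKs hK hs
    obtain ⟨X', hX'⟩ := (((equivariant_spec_toC hKs U).mul
      ((eQ.mul eD).mul eR.conjTranspose)).mul
      (equivariant_spec_toC hKs V).conjTranspose).exists_spec_eq hKs hK hs
    have unitary_mul : ∀ {k : ℕ} {A B : Matrix (Fin k) (Fin k) ℂ}, Aᴴ * A = 1 → Bᴴ * B = 1 →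
        (A * B)ᴴ * (A * B) = 1 := by
      intro k A B hA hB
      rw [Matrix.conjTranspose_mul, Matrix.mul_assoc, ← Matrix.mul_assoc Aᴴ, hA, Matrix.one_mul,
        hB]
    have h' : IsTSVD T U' D V' X' := by
      rw [isTSVD_iff hK]
      refine ⟨fun f => ?_, fun f => ?_, hdiag, fun f => ?_⟩
      · rw [hU']; exact unitary_mul (hU f) (hQ f)
      · rw [hV']; exact unitary_mul (hV f) (hR f)
      · rw [hU', hV', hX', Matrix.conjTranspose_mul]
        simp only [Matrix.mul_assoc]
        rfl
    have hmin := hX X'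
    have hle := mul_le_mul_of_nonneg_left (h'.nuclearL1_le p) hlam.le
    rw [hD] at hmin
    have hfrob : ρ * frobSq (X - Z) ≤ ρ * frobSq (X' - Z) :=
      mul_le_mul_of_nonneg_left (by linarith) hρ.le
    rw [hT.frobSq_sub hU hV hXf hZ, hT.frobSq_sub hU hV hX' hZ] at hfrob
    simp only [normSq_sub, Finset.sum_sub_distrib, Finset.sum_add_distrib,
      normSq_unitary_mul_mul (hQ _) (hR _), ← Finset.mul_sum] at hfrob
    linarith
  have eOne : ∀ k : ℕ, Equivariant s fun _ => (1 : Matrix (Fin k) (Fin k) ℂ) :=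
    fun k f => map_star_one.symm
  constructor
  · refine (eD.mul hY.conjTranspose).isHermitian_of_trace_le hs fun Q eQ hQ => ?_
    have := key Q (fun _ => 1) eQ (eOne b) hQ (by simp)
    simpa only [Matrix.conjTranspose_one, Matrix.mul_one, Matrix.mul_assoc] using this
  · intro f
    have hH := (hY.conjTranspose.mul eD).isHermitian_of_trace_le hs (fun R eR hR => by
      have := key (fun _ => 1) (fun f => (R f)ᴴ) (eOne a) eR.conjTranspose (by simp)
        (fun f => by rw [Matrix.conjTranspose_conjTranspose]; exact mul_eq_one_comm.mp (hR f))
      simp only [Matrix.conjTranspose_conjTranspose, Matrix.one_mul] at this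
      calc ∑ f, (R f * ((Y f)ᴴ * Df f)).trace.re = ∑ f, (Df f * R f * (Y f)ᴴ).trace.re := by
            refine Finset.sum_congr rfl fun f _ => ?_
            rw [← Matrix.mul_assoc, Matrix.trace_mul_comm, Matrix.mul_assoc]
        _ ≤ _ := this
        _ = _ := Finset.sum_congr rfl fun f _ => by rw [Matrix.trace_mul_comm]) f
    have := hH.conjTranspose
    simpa only [Matrix.conjTranspose_mul, Matrix.conjTranspose_conjTranspose] using this

end TSVD

end LTensor

/-! ### A common frame for the minimizer and the data. -/

theorem theorem3p1 {r : ℕ} (n : Fin r → ℕ) (n₁ n₂ : ℕ)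
    (T : LTensor.TransformMatrices n)
    (ρ : ℝ) (hρ : 0 < ρ) (hT : LTensor.ScaledUnitary T ρ) (hreal : LTensor.ProductReal T)
    (lam p : ℝ) (hlam : 0 < lam) (hp : 1 ≤ p)
    (Z X : LTensor.Tensor ℝ n₁ n₂ n) (hX : X ∈ LTensor.proxNuclear T lam p Z) :
    ∃ (U : LTensor.Tensor ℝ n₁ n₁ n) (S : LTensor.Tensor ℝ n₁ n₂ n)
      (V : LTensor.Tensor ℝ n₂ n₂ n),
      LTensor.IsTSVD T U S V Z ∧
      ∃ D ∈ LTensor.proxL1 lam p S,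
        LTensor.toC X = LTensor.tProd T (LTensor.tProd T (LTensor.toC U) (LTensor.toC D))
          (LTensor.ctrans T (LTensor.toC V)) := by
  open LTensor in
  have hp0 : 0 ≤ p := zero_le_one.trans hp
  have hK := hT.kron_mul_inv hρ
  obtain ⟨s, hs, hKs⟩ := hreal.exists_involution hK
  obtain ⟨U₁, D, V₁, hX₁, hD⟩ := exists_isTSVD_nuclearL1_eq hρ hT hs hKs hp0 X
  obtain ⟨hU₁, hV₁, hdiag, hXf⟩ := (isTSVD_iff hK _ _ _ _).1 hX₁
  have eU := equivariant_spec_toC hKs U₁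
  have eV := equivariant_spec_toC hKs V₁
  have eD := equivariant_spec_toC hKs D
  set Y : Idx n → Matrix (Fin n₁) (Fin n₂) ℂ := fun f =>
    (spec T (toC U₁) f)ᴴ * spec T (toC Z) f * spec T (toC V₁) f with hYdef
  have eY : Equivariant s Y := (eU.conjTranspose.mul (equivariant_spec_toC hKs Z)).mul eV
  have hZY : ∀ f, spec T (toC Z) f = spec T (toC U₁) f * Y f * (spec T (toC V₁) f)ᴴ := by
    intro f
    calc spec T (toC Z) f = (spec T (toC U₁) f * (spec T (toC U₁) f)ᴴ) * spec T (toC Z) f *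
          (spec T (toC V₁) f * (spec T (toC V₁) f)ᴴ) := by
          rw [mul_eq_one_comm.mp (hU₁ f), mul_eq_one_comm.mp (hV₁ f), Matrix.one_mul,
            Matrix.mul_one]
      _ = _ := by simp only [hYdef, Matrix.mul_assoc]
  obtain ⟨h₁, h₂⟩ := isHermitian_of_mem_proxNuclear hρ hT hs hKs hlam hX hX₁ hD eY hZY
  -- This removes the remaining freedom in the t-SVD of `X`: rotating by `Q`, `R` leaves the optimal
  -- core `D` intact, so `nuclearL1` is still computed by it, while `Z` becomes f-diagonal.
  obtain ⟨Q, R, eQ, eR, hQ, hR, hQDR, hQYR⟩ := Equivariant.exists_stabilizer_diagonalize hs eD eY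
    ((isFDiagonal_iff hK D).1 hdiag) h₁ h₂
  have hQ' : ∀ f, Q f * (Q f)ᴴ = 1 := fun f => mul_eq_one_comm.mp (hQ f)
  have hR' : ∀ f, R f * (R f)ᴴ = 1 := fun f => mul_eq_one_comm.mp (hR f)
  obtain ⟨U, hU⟩ := (eU.mul eQ).exists_spec_eq hKs hK hs
  obtain ⟨V, hV⟩ := (eV.mul eR).exists_spec_eq hKs hK hs
  obtain ⟨S, hS⟩ := ((eQ.conjTranspose.mul eY).mul eR).exists_spec_eq hKs hK hs
  have oU : ∀ f, (spec T (toC U) f)ᴴ * spec T (toC U) f = 1 := fun f => by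
    rw [hU, Matrix.conjTranspose_mul, Matrix.mul_assoc, ← Matrix.mul_assoc _ _ (Q f), hU₁,
      Matrix.one_mul, hQ]
  have oV : ∀ f, (spec T (toC V) f)ᴴ * spec T (toC V) f = 1 := fun f => by
    rw [hV, Matrix.conjTranspose_mul, Matrix.mul_assoc, ← Matrix.mul_assoc _ _ (R f), hV₁,
      Matrix.one_mul, hR]
  have transfer : ∀ f (A : Matrix (Fin n₁) (Fin n₂) ℂ),
      spec T (toC U₁) f * A * (spec T (toC V₁) f)ᴴ =
        spec T (toC U) f * ((Q f)ᴴ * A * R f) * (spec T (toC V) f)ᴴ := by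
    intro f A
    rw [hU, hV, Matrix.conjTranspose_mul]
    calc spec T (toC U₁) f * A * (spec T (toC V₁) f)ᴴ =
          spec T (toC U₁) f * ((Q f * (Q f)ᴴ) * A * (R f * (R f)ᴴ)) *
            (spec T (toC V₁) f)ᴴ := by rw [hQ', hR', Matrix.one_mul, Matrix.mul_one]
      _ = _ := by simp only [Matrix.mul_assoc]
  have hZS : ∀ f, spec T (toC Z) f =
      spec T (toC U) f * spec T (toC S) f * (spec T (toC V) f)ᴴ := fun f => by
    rw [hZY, transfer, hS]
  have hXD : ∀ f, spec T (toC X) f =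
      spec T (toC U) f * spec T (toC D) f * (spec T (toC V) f)ᴴ := fun f => by
    rw [hXf, transfer, hQDR]
  have hSdiag : IsFDiagonal S := by
    rw [isFDiagonal_iff hK]
    simpa only [hS] using hQYR
  refine ⟨U, S, V, (isTSVD_iff hK _ _ _ _).2 ⟨oU, oV, hSdiag, hZS⟩, D, ?_,
    (eq_tProd_iff hK _ _ _ _).2 hXD⟩
  refine mem_proxL1_of_fDiagonal hlam.le hp0 hSdiag fun D' hD' => ?_
  -- For f-diagonal `D'` the tensor with core `D'` in the common frame is an admissible competitor.
  -- Its penalty is at most that of `D'`, with equality for `X` and `D`, and the distances to `Z`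
  -- become distances to `S`.
  obtain ⟨X', hX'⟩ := (((equivariant_spec_toC hKs U).mul (equivariant_spec_toC hKs D')).mul
    (equivariant_spec_toC hKs V).conjTranspose).exists_spec_eq hKs hK hs
  have hN : IsTSVD T U D' V X' := (isTSVD_iff hK _ _ _ _).2 ⟨oU, oV, hD', hX'⟩
  have hle := mul_le_mul_of_nonneg_left (hN.nuclearL1_le p) hlam.le
  have hmin := hX X'
  have f₁ : frobSq (X - Z) = frobSq (D - S) := by
    refine mul_left_cancel₀ hρ.ne' ?_
    rw [hT.frobSq_sub oU oV hXD hZS, ← hT.sum_normSq_spec]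
    simp only [spec_sub]
  have f₂ : frobSq (X' - Z) = frobSq (D' - S) := by
    refine mul_left_cancel₀ hρ.ne' ?_
    rw [hT.frobSq_sub oU oV hX' hZS, ← hT.sum_normSq_spec]
    simp only [spec_sub]
  rw [hD, f₁, f₂] at hmin
  linarith
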